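/- Let $1\le d<n$ be integers and let $\Gamma\subset\mathbb R^n$ be a bounded Borel set with $\mathcal H^d(\Gamma)<\infty$, where $\mathcal H^d$ is the $d$-dimensional Hausdorff measure, normalized to agree with Lebesgue measure on $d$-planes. Let $\mu$ be $\mathcal H^d$ restricted to $\Gamma$ or, more generally, a Borel measure such that $c^{-1}\,\mathcal H^d|_\Gamma\le\mu\le c\,\mathcal H^d|_\Gamma$ for some $c\geq 1$ (for example the surface measure on a bounded piece of a Lipschitz graph). For $t>0$ and $x\in\mathbb R^n$ put $$K_t(x)=t^{-d/2}e^{-\pi|x|^2/t},\qquad \psi_t(x)=t\,\frac{\partial K_t}{\partial t}(x),\qquad S\Gamma(x,t)=\int_\Gamma\psi_t(x-y)\,d\mu(y).$$ Fix $a>1$ and write $S\Gamma(x,\tau)=S\Gamma(x,t)$ when $\tau=\log_a t$. Assume: (i) for every integer $k\ge 0$ there is a constant $C_k$ with $$\sup_{x\in\Gamma}\left|\frac{\partial^k}{\partial\tau^k}S\Gamma(x,\tau)\right|\le C_k\quad\text{for all }\tau\in\mathbb R;$$ (ii) for every integer $k\ge1$ the Littlewood–Paley function is bounded on $L^2(\mu)$: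 there is a constant $C$ (which may depend on $k$) such that for all $f\in L^2(\mu)$ $$\left[\int_\Gamma\int_0^\infty\left|t^k\int_\Gamma\frac{\partial^kK_t}{\partial t^k}(x-y)f(y)\,d\mu(y)\right|^2\frac{dt}{t}\,d\mu(x)\right]^{1/2}\le C\,\|f\|_{L^2(\mu)}.$$ For $x\in\Gamma$ let $\mathcal T_\Gamma(x)$ be the set of all $\tau=\log_a t$, $t>0$, such that $s\mapsto|S\Gamma(x,s)|$ has a local maximum at $s=t$ (the local scales of $\Gamma$ at $x$). For $\beta,\delta>0$ let $$\tau_{\beta,\delta}(x)=\left\{\tau\in\mathcal T_\Gamma(x):\ |S\Gamma(x,\tau)|>\beta,\ \left|\frac{\partial^2}{\partial\tau^2}S\Gamma(x,\tau)\right|>\delta\right\}$$ (the local scales that are $\beta$-visible and $\delta$-separated), and for integers $N\ge0$ let $\Gamma_{\beta,\delta,N}=\{x\in\Gamma:\#\tau_{\beta,\delta}(x)\ge N\}$. Then there exist constants $C_1,C_2>0$, depending on $\Gamma$, $\mu$ and $a$ but not on $\beta,\delta,N$, such that for all $\beta,\delta>0$ and all integers $N\ge 0$ $$\mu(\Gamma_{\beta,\delta,N})\le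 C_1e^{-C_2N\delta^2\alpha},\qquad \alpha=\min(\beta,\delta).$$ -/

import Mathlib

open MeasureTheory Set
open scoped NNReal ENNReal

namespace LocalScales

noncomputable section

/-- The kernel `K_t(x) = t^{-d/2} exp(-π |x|² / t)` on `ℝⁿ`, normalized for `d`-planes (`t > 0`). -/
def heatKernel {n : ℕ} (d : ℕ) (t : ℝ) (x : EuclideanSpace ℝ (Fin n)) : ℝ :=
  t ^ (-(d : ℝ) / 2) * Real.exp (-(Real.pi * ‖x‖ ^ 2 / t))

/-- `ψ_t(x) = t ∂K_t(x)/∂t`. -/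
def psi {n : ℕ} (d : ℕ) (t : ℝ) (x : EuclideanSpace ℝ (Fin n)) : ℝ :=
  t * deriv (fun s => heatKernel d s x) t

/-- `SΓ(x,t) = (ψ_t * μ)(x) = ∫ ψ_t(x - y) dμ(y)`, where `μ` is the measure carried by `Γ`. -/
def S {n : ℕ} (d : ℕ) (μ : Measure (EuclideanSpace ℝ (Fin n)))
    (x : EuclideanSpace ℝ (Fin n)) (t : ℝ) : ℝ :=
  ∫ y, psi d t (x - y) ∂μ

/-- `SΓ(x,τ) = SΓ(x,t)` in the logarithmic variable `τ = log_a t`. -/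
def SLog {n : ℕ} (d : ℕ) (μ : Measure (EuclideanSpace ℝ (Fin n))) (a : ℝ)
    (x : EuclideanSpace ℝ (Fin n)) (τ : ℝ) : ℝ :=
  S d μ x (a ^ τ)

/-- `μ` is a `d`-dimensional surface-type measure on `Γ`: it is carried by `Γ` and comparable,
with constants, to the `d`-dimensional Hausdorff measure restricted to `Γ`. This includes the
Hausdorff measure itself (see `isSurfaceMeasure_hausdorff`) and, on a Lipschitz graph, both the
surface measure `√(det g) dr` and the parameter measure `dr`. -/
def IsSurfaceMeasure {n : ℕ} (d : ℕ) (Γ : Set (EuclideanSpace ℝ (Fin n)))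
    (μ : Measure (EuclideanSpace ℝ (Fin n))) : Prop :=
  ∃ c : ℝ≥0, μ ≤ c • (Measure.euclideanHausdorffMeasure d).restrict Γ ∧
    (Measure.euclideanHausdorffMeasure d).restrict Γ ≤ c • μ

theorem isSurfaceMeasure_hausdorff {n : ℕ} (d : ℕ) (Γ : Set (EuclideanSpace ℝ (Fin n))) :
    IsSurfaceMeasure d Γ ((Measure.euclideanHausdorffMeasure d).restrict Γ) :=
  ⟨1, by simp, by simp⟩

/-- The Littlewood-Paley function
`g_k(f)(x) = (∫₀^∞ |t^k (∂^k K_t/∂t^k) * f (x)|² dt/t)^{1/2}`, the convolution being with `f dμ`. -/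
def littlewoodPaley {n : ℕ} (d : ℕ) (μ : Measure (EuclideanSpace ℝ (Fin n))) (k : ℕ)
    (f : EuclideanSpace ℝ (Fin n) → ℝ) (x : EuclideanSpace ℝ (Fin n)) : ℝ≥0∞ :=
  (∫⁻ t in Ioi (0 : ℝ), ENNReal.ofReal
    ((t ^ k * ∫ y, iteratedDeriv k (fun s => heatKernel d s (x - y)) t * f y ∂μ) ^ 2 / t))
      ^ (1 / 2 : ℝ)

/-- `L²(μ)`-boundedness of all the Littlewood-Paley functions `g_k`, `k ≥ 1`. (For `k = 0` the
integral in `t` diverges at `0`.) -/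
def LittlewoodPaleyBounded {n : ℕ} (d : ℕ) (μ : Measure (EuclideanSpace ℝ (Fin n))) : Prop :=
  ∀ k : ℕ, 1 ≤ k → ∃ C : ℝ≥0, ∀ f : EuclideanSpace ℝ (Fin n) → ℝ, MemLp f 2 μ →
    eLpNorm (littlewoodPaley d μ k f) 2 μ ≤ C * eLpNorm f 2 μ

/-- `sup_{x ∈ Γ} |∂^k SΓ(x,τ)/∂τ^k| ≤ C_k` for every `k ≥ 0`, uniformly in `τ`. -/
def LogDerivBounded {n : ℕ} (d : ℕ) (Γ : Set (EuclideanSpace ℝ (Fin n)))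
    (μ : Measure (EuclideanSpace ℝ (Fin n))) (a : ℝ) : Prop :=
  ∀ k : ℕ, ∃ C : ℝ, ∀ x ∈ Γ, ∀ τ : ℝ, |iteratedDeriv k (SLog d μ a x) τ| ≤ C

/-- The local scales `T_Γ(x) = {t > 0 : |SΓ(x,·)| has a local maximum at t}`. -/
def localScales {n : ℕ} (d : ℕ) (μ : Measure (EuclideanSpace ℝ (Fin n)))
    (x : EuclideanSpace ℝ (Fin n)) : Set ℝ :=
  {t | 0 < t ∧ IsLocalMax (fun s => |S d μ x s|) t}

/-- The local scales in the logarithmic variable: `{log_a t : t ∈ T_Γ(x)}`. -/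
def logLocalScales {n : ℕ} (d : ℕ) (μ : Measure (EuclideanSpace ℝ (Fin n))) (a : ℝ)
    (x : EuclideanSpace ℝ (Fin n)) : Set ℝ :=
  (fun t => Real.logb a t) '' localScales d μ x

/-- `τ` is `β`-visible at `x`: `|SΓ(x,τ)| > β`. -/
def IsVisible {n : ℕ} (d : ℕ) (μ : Measure (EuclideanSpace ℝ (Fin n))) (a β : ℝ)
    (x : EuclideanSpace ℝ (Fin n)) (τ : ℝ) : Prop :=
  β < |SLog d μ a x τ|

/-- `τ` is `δ`-separated at `x`: `|∂²SΓ(x,τ)/∂τ²| > δ`. -/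
def IsSeparated {n : ℕ} (d : ℕ) (μ : Measure (EuclideanSpace ℝ (Fin n))) (a δ : ℝ)
    (x : EuclideanSpace ℝ (Fin n)) (τ : ℝ) : Prop :=
  δ < |iteratedDeriv 2 (SLog d μ a x) τ|

/-- `τ_{β,δ}(x)`: the logarithmic local scales at `x` that are `β`-visible and `δ`-separated. -/
def visibleSeparatedScales {n : ℕ} (d : ℕ) (μ : Measure (EuclideanSpace ℝ (Fin n))) (a β δ : ℝ)
    (x : EuclideanSpace ℝ (Fin n)) : Set ℝ :=
  {τ | τ ∈ logLocalScales d μ a x ∧ IsVisible d μ a β x τ ∧ IsSeparated d μ a δ x τ}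

/-- `Γ_{β,δ,N} = {x ∈ Γ : #τ_{β,δ}(x) ≥ N}`. -/
def manyScales {n : ℕ} (d : ℕ) (Γ : Set (EuclideanSpace ℝ (Fin n)))
    (μ : Measure (EuclideanSpace ℝ (Fin n))) (a β δ : ℝ) (N : ℕ) :
    Set (EuclideanSpace ℝ (Fin n)) :=
  {x | x ∈ Γ ∧ (N : ℕ∞) ≤ (visibleSeparatedScales d μ a β δ x).encard}

end

end LocalScales

/-! Fix `x` and let `f` be `SΓ(x,·)` as a function of `τ`. At a visible local scale `f ≠ 0`, so a
maximum of `|f|` forces `f' = 0`. Between two such scales `f''` vanishes by Rolle, while `|f''| > δ`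
at the scales themselves. With `|f'''| ≤ B` they are therefore more than `δ/B` apart, and `|f''| >
δ/2` on disjoint intervals of radius `δ/(2B)` around them. Each interval contributes at least
`δ³/(4B)` to `∫ |f''|² dτ`. Hence `N` scales force the square function of the kernel `(t∂ₜ)³Kₜ` to
be at least `cNδ³` at `x` (`exists_manyScales_subset`), and `δ³ ≥ δ² min(β,δ)`.

What remains is exponential integrability of that square function (`exists_measure_sqFun_exp`).
Since `(t∂ₜ)³` is a combination of `tᵏ∂ₜᵏ`, `k = 1, 2, 3`, it inherits an `L²` bound, needed only on
indicators. The `k = 1` bound tested on a ball also gives `μ(B(x,r)) ≲ r^d`; consequently potentials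
are bounded, vary slowly at distances below `√t`, and depend little on mass at distances much larger
than `√t`.

These facts give a good-λ inequality (`exists_measure_sqFun_half`). Where the square function
exceeds `l + 1`, stop at a scale `s` at which the part over `t > s` still exceeds `l + 1` but the
part over `t > 2s` does not. The part over `t > s` changes by at most 1 on a ball of radius `κ√s`,
so the union `E` of all these balls lies in the level set at height `l`. Scales `t ≤ 2s` see only
`μ` on `E`, up to a bounded error. A value above `l + K` thus makes the square function of `μ`
restricted to `E` large, and Chebyshev with the test on `1_E` bounds the measure of such points by
half that of the level set at `l`. Testing on the whole union at once replaces any covering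
argument. -/

namespace LocalScales

open Polynomial

variable {n : ℕ}

/-! ### Polynomial Gaussian kernels and the Euler operator -/

/-- The kernel `t^{-d/2} e^{-v} P(v)`, where `v = π |x|² / t`. -/
noncomputable def polyKernel {n : ℕ} (d : ℕ) (P : ℝ[X]) (t : ℝ)
    (x : EuclideanSpace ℝ (Fin n)) : ℝ :=
  t ^ (-(d : ℝ) / 2) * (Real.exp (-(Real.pi * ‖x‖ ^ 2 / t)) * P.eval (Real.pi * ‖x‖ ^ 2 / t))

/-- The action of `t ∂/∂t` on polynomial Gaussian kernels. -/
noncomputable def eulerOp (d : ℕ) (P : ℝ[X]) : ℝ[X] :=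
  (X - C ((d : ℝ) / 2)) * P - X * derivative P

/-- The polynomial of the kernel `t^k ∂^k K_t / ∂t^k`. -/
noncomputable def heatPoly (d : ℕ) : ℕ → ℝ[X]
  | 0 => 1
  | k + 1 => eulerOp d (heatPoly d k) - C (k : ℝ) * heatPoly d k

theorem hasDerivAt_polyKernel (d : ℕ) (P : ℝ[X]) (x : EuclideanSpace ℝ (Fin n)) {t : ℝ}
    (ht : 0 < t) :
    HasDerivAt (fun s => polyKernel d P s x) (polyKernel d (eulerOp d P) t x / t) t := by
  have h1 : HasDerivAt (fun s : ℝ => s ^ (-(d : ℝ) / 2))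
      ((-(d : ℝ) / 2) * t ^ (-(d : ℝ) / 2 - 1)) t :=
    Real.hasDerivAt_rpow_const (Or.inl ht.ne')
  have h2 : HasDerivAt (fun s : ℝ => Real.pi * ‖x‖ ^ 2 / s) (-(Real.pi * ‖x‖ ^ 2) / t ^ 2) t := by
    refine ((hasDerivAt_const t (Real.pi * ‖x‖ ^ 2)).fun_div (hasDerivAt_id t) ht.ne').congr_deriv ?_
    simp
  have h3 := h2.neg.exp
  have h4 : HasDerivAt (fun s : ℝ => P.eval (Real.pi * ‖x‖ ^ 2 / s))
      ((derivative P).eval (Real.pi * ‖x‖ ^ 2 / t) * (-(Real.pi * ‖x‖ ^ 2) / t ^ 2)) t :=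
    (P.hasDerivAt _).comp t h2
  have h5 := h1.mul (h3.mul h4)
  refine h5.congr_deriv ?_
  simp only [polyKernel, eulerOp, eval_sub, eval_mul, eval_X, eval_C, Pi.mul_apply, Pi.neg_apply]
  rw [Real.rpow_sub_one ht.ne']
  field_simp
  ring

theorem heatKernel_eq_polyKernel (d : ℕ) (t : ℝ) (x : EuclideanSpace ℝ (Fin n)) :
    heatKernel d t x = polyKernel d 1 t x := by
  simp [heatKernel, polyKernel]

theorem polyKernel_sub (d : ℕ) (P Q : ℝ[X]) (t : ℝ) (x : EuclideanSpace ℝ (Fin n)) :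
    polyKernel d (P - Q) t x = polyKernel d P t x - polyKernel d Q t x := by
  simp only [polyKernel, eval_sub]; ring

theorem polyKernel_add (d : ℕ) (P Q : ℝ[X]) (t : ℝ) (x : EuclideanSpace ℝ (Fin n)) :
    polyKernel d (P + Q) t x = polyKernel d P t x + polyKernel d Q t x := by
  simp only [polyKernel, eval_add]; ring

theorem polyKernel_C_mul (d : ℕ) (c : ℝ) (P : ℝ[X]) (t : ℝ) (x : EuclideanSpace ℝ (Fin n)) :
    polyKernel d (C c * P) t x = c * polyKernel d P t x := by
  simp only [polyKernel, eval_mul, eval_C]; ring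

theorem iteratedDeriv_heatKernel (d k : ℕ) (x : EuclideanSpace ℝ (Fin n)) {t : ℝ} (ht : 0 < t) :
    iteratedDeriv k (fun s => heatKernel d s x) t = polyKernel d (heatPoly d k) t x / t ^ k := by
  induction k generalizing t with
  | zero => simp [heatPoly, heatKernel_eq_polyKernel]
  | succ k ih =>
    have hev : iteratedDeriv k (fun s => heatKernel d s x) =ᶠ[nhds t]
        fun s => polyKernel d (heatPoly d k) s x / s ^ k := by
      filter_upwards [Ioi_mem_nhds ht] with s hs using ih hs
    rw [iteratedDeriv_succ, hev.deriv_eq]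
    have h := (hasDerivAt_polyKernel d (heatPoly d k) x ht).fun_div (hasDerivAt_pow k t)
      (pow_ne_zero k ht.ne')
    rw [h.deriv, heatPoly, polyKernel_sub, polyKernel_C_mul]
    cases k with
    | zero => simp
    | succ k =>
      simp only [Nat.add_sub_cancel]
      field_simp
      ring

theorem psi_eq_polyKernel (d : ℕ) (x : EuclideanSpace ℝ (Fin n)) {t : ℝ} (ht : 0 < t) :
    psi d t x = polyKernel d (eulerOp d 1) t x := by
  have h : (fun s => heatKernel d s x) = fun s => polyKernel d 1 s x :=
    funext fun s => heatKernel_eq_polyKernel d s x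
  rw [psi, h, (hasDerivAt_polyKernel d 1 x ht).deriv, mul_div_cancel₀ _ ht.ne']

/-- The operator identity `(t∂)³ = t∂ + 3t²∂² + t³∂³`; it transfers the Littlewood–Paley bounds to
the kernel of `∂²SΓ/∂τ²`. -/
theorem eulerOp_iterate_three (d : ℕ) :
    (eulerOp d)^[3] 1 = heatPoly d 1 + C 3 * heatPoly d 2 + heatPoly d 3 := by
  simp only [Function.iterate_succ, Function.iterate_zero, Function.comp, id, heatPoly, eulerOp]
  simp only [map_sub, map_add, derivative_mul, derivative_X, derivative_C, derivative_one,
    derivative_zero, Nat.cast_zero, Nat.cast_one, C_0, C_1, Nat.cast_ofNat, C_ofNat]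
  ring

/-! ### Size and Lipschitz bounds for the kernels -/

theorem exists_abs_polyEval_le_exp (P : ℝ[X]) {c : ℝ} (hc : 0 < c) :
    ∃ B : ℝ, 0 ≤ B ∧ ∀ v : ℝ, 0 ≤ v → |P.eval v| ≤ B * Real.exp (c * v) := by
  induction P using Polynomial.induction_on' with
  | add P Q hP hQ =>
    obtain ⟨A, hA, hP⟩ := hP
    obtain ⟨B, hB, hQ⟩ := hQ
    refine ⟨A + B, by positivity, fun v hv => ?_⟩
    rw [eval_add, add_mul]
    exact (abs_add_le _ _).trans (add_le_add (hP v hv) (hQ v hv))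
  | monomial k b =>
    refine ⟨|b| * (k.factorial / c ^ k), by positivity, fun v hv => ?_⟩
    have h := Real.pow_div_factorial_le_exp (c * v) (by positivity) k
    rw [eval_monomial, abs_mul, abs_of_nonneg (pow_nonneg hv k), mul_assoc]
    refine mul_le_mul_of_nonneg_left ?_ (abs_nonneg b)
    rw [div_le_iff₀ (by positivity), mul_pow] at h
    rw [div_mul_eq_mul_div, le_div_iff₀ (by positivity)]
    linarith

/-- The polynomial costs half of the exponent `v = π|x|²/t`; since `π/2 > 1`, a full `exp(-|x|²/t)`
survives. -/
theorem exists_abs_polyKernel_le (d : ℕ) (P : ℝ[X]) :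
    ∃ B : ℝ, 0 ≤ B ∧ ∀ (t : ℝ) (x : EuclideanSpace ℝ (Fin n)), 0 < t →
      |polyKernel d P t x| ≤ B * (t ^ (-(d : ℝ) / 2) * Real.exp (-(‖x‖ ^ 2 / t))) := by
  have hpi := Real.pi_gt_three
  obtain ⟨B, hB, h⟩ := exists_abs_polyEval_le_exp P (c := 1 / 2) (by norm_num)
  refine ⟨B, hB, fun t x ht => ?_⟩
  have hv : 0 ≤ Real.pi * ‖x‖ ^ 2 / t := by positivity
  rw [polyKernel, abs_mul, abs_mul, abs_of_nonneg (Real.rpow_nonneg ht.le _), Real.abs_exp,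
    mul_left_comm B]
  refine mul_le_mul_of_nonneg_left ?_ (Real.rpow_nonneg ht.le _)
  calc _ ≤ Real.exp (-(Real.pi * ‖x‖ ^ 2 / t)) * (B * Real.exp (1 / 2 * (Real.pi * ‖x‖ ^ 2 / t))) :=
        mul_le_mul_of_nonneg_left (h _ hv) (Real.exp_nonneg _)
    _ = B * Real.exp (-(Real.pi * ‖x‖ ^ 2 / t) + 1 / 2 * (Real.pi * ‖x‖ ^ 2 / t)) := by
        rw [Real.exp_add]; ring
    _ ≤ _ := by
        refine mul_le_mul_of_nonneg_left (Real.exp_le_exp.2 ?_) hB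
        have : 0 ≤ ‖x‖ ^ 2 / t := by positivity
        rw [mul_div_assoc]
        nlinarith

/-- The variable is `r = √v` because `r = √π|x|/√t` is Lipschitz in `x` with constant of order
`1/√t`. -/
theorem exists_abs_gaussPoly_sub_le (P : ℝ[X]) :
    ∃ B : ℝ, 0 ≤ B ∧ ∀ r s : ℝ, 0 ≤ r → 0 ≤ s →
      |Real.exp (-r ^ 2) * P.eval (r ^ 2) - Real.exp (-s ^ 2) * P.eval (s ^ 2)| ≤
        B * |r - s| * (Real.exp (-(r ^ 2 / 2)) + Real.exp (-(s ^ 2 / 2))) := by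
  obtain ⟨B, hB, h⟩ := exists_abs_polyEval_le_exp (derivative P - P) (c := 1 / 4)
    (by norm_num)
  have hder : ∀ u : ℝ, HasDerivAt (fun r : ℝ => Real.exp (-r ^ 2) * P.eval (r ^ 2))
      (2 * u * (Real.exp (-u ^ 2) * (derivative P - P).eval (u ^ 2))) u := by
    intro u
    have h1 : HasDerivAt (fun r : ℝ => r ^ 2) (2 * u) u := by simpa using hasDerivAt_pow 2 u
    have h2 := h1.fun_neg.exp.mul ((P.hasDerivAt _).comp u h1)
    refine h2.congr_deriv ?_
    simp only [Function.comp, eval_sub]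
    ring
  have key : ∀ r s : ℝ, 0 ≤ r → r ≤ s →
      |Real.exp (-r ^ 2) * P.eval (r ^ 2) - Real.exp (-s ^ 2) * P.eval (s ^ 2)| ≤
        4 * B * |r - s| * Real.exp (-(r ^ 2 / 2)) := by
    intro r s hr hrs
    have := (convex_Icc r s).norm_image_sub_le_of_norm_hasDerivWithin_le
      (f := fun r : ℝ => Real.exp (-r ^ 2) * P.eval (r ^ 2))
      (f' := fun u => 2 * u * (Real.exp (-u ^ 2) * (derivative P - P).eval (u ^ 2)))
      (C := 4 * B * Real.exp (-(r ^ 2 / 2))) (x := s) (y := r)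
      (fun u _ => (hder u).hasDerivWithinAt) ?_ (right_mem_Icc.2 hrs) (left_mem_Icc.2 hrs)
    · simp only [Real.norm_eq_abs] at this
      linarith
    · intro u hu
      have hu0 : 0 ≤ u := hr.trans hu.1
      have hb := h (u ^ 2) (by positivity)
      -- Exponent budget: a quarter of `u²` absorbs the factor `2u`, a quarter the polynomial, and
      -- half is left.
      have h2u : 2 * u ≤ 4 * Real.exp (u ^ 2 / 4) := by
        have := Real.add_one_le_exp (u ^ 2 / 4)
        nlinarith [sq_nonneg (u - 1)]
      rw [Real.norm_eq_abs, abs_mul, abs_mul (Real.exp _), Real.abs_exp,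
        abs_of_nonneg (by positivity : 0 ≤ 2 * u)]
      calc _ ≤ (4 * Real.exp (u ^ 2 / 4)) * (Real.exp (-u ^ 2) * (B * Real.exp (1 / 4 * u ^ 2))) := by
            gcongr
        _ = 4 * B * Real.exp (u ^ 2 / 4 + (-u ^ 2 + 1 / 4 * u ^ 2)) := by
            rw [Real.exp_add, Real.exp_add]; ring
        _ ≤ _ := by
            have := pow_le_pow_left₀ hr hu.1 2
            gcongr
            linarith
  refine ⟨4 * B, by positivity, fun r s hr hs => ?_⟩
  have hr0 := Real.exp_nonneg (-(r ^ 2 / 2))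
  have hs0 := Real.exp_nonneg (-(s ^ 2 / 2))
  have hc : 0 ≤ 4 * B * |r - s| := by positivity
  rcases le_total r s with hrs | hrs
  · exact (key r s hr hrs).trans (mul_le_mul_of_nonneg_left (by linarith) hc)
  · have := key s r hs hrs
    rw [abs_sub_comm, abs_sub_comm s r] at this
    exact this.trans (mul_le_mul_of_nonneg_left (by linarith) hc)

theorem exists_abs_polyKernel_sub_le (d : ℕ) (P : ℝ[X]) :
    ∃ B : ℝ, 0 ≤ B ∧ ∀ (t : ℝ) (x y : EuclideanSpace ℝ (Fin n)), 0 < t →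
      |polyKernel d P t x - polyKernel d P t y| ≤ B * (‖x - y‖ / √t) *
        (t ^ (-(d : ℝ) / 2) * Real.exp (-(‖x‖ ^ 2 / t)) +
          t ^ (-(d : ℝ) / 2) * Real.exp (-(‖y‖ ^ 2 / t))) := by
  have hpi := Real.pi_gt_three
  obtain ⟨B, hB, h⟩ := exists_abs_gaussPoly_sub_le P
  refine ⟨B * √Real.pi, by positivity, fun t x y ht => ?_⟩
  have hst := Real.sqrt_pos.2 ht
  have hsq : ∀ z : EuclideanSpace ℝ (Fin n),
      (√Real.pi * ‖z‖ / √t) ^ 2 = Real.pi * ‖z‖ ^ 2 / t := fun z => by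
    rw [div_pow, mul_pow, Real.sq_sqrt Real.pi_pos.le, Real.sq_sqrt ht.le]
  have h1 := h (√Real.pi * ‖x‖ / √t) (√Real.pi * ‖y‖ / √t) (by positivity) (by positivity)
  rw [hsq, hsq] at h1
  have h2 : |√Real.pi * ‖x‖ / √t - √Real.pi * ‖y‖ / √t| ≤ √Real.pi * (‖x - y‖ / √t) := by
    rw [show √Real.pi * ‖x‖ / √t - √Real.pi * ‖y‖ / √t = √Real.pi * ((‖x‖ - ‖y‖) / √t) by ring,
      abs_mul, abs_of_nonneg (Real.sqrt_nonneg _), abs_div, abs_of_pos hst]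
    gcongr
    exact abs_norm_sub_norm_le x y
  have h3 : ∀ z : EuclideanSpace ℝ (Fin n),
      Real.exp (-(Real.pi * ‖z‖ ^ 2 / t / 2)) ≤ Real.exp (-(‖z‖ ^ 2 / t)) := fun z => by
    refine Real.exp_le_exp.2 ?_
    have : 0 ≤ ‖z‖ ^ 2 / t := by positivity
    rw [mul_div_assoc]
    nlinarith
  have ht0 := Real.rpow_nonneg ht.le (-(d : ℝ) / 2)
  rw [polyKernel, polyKernel, ← mul_sub, abs_mul, abs_of_nonneg ht0, ← mul_add, mul_left_comm]
  refine mul_le_mul_of_nonneg_left (h1.trans ?_) ht0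
  rw [mul_assoc B (√Real.pi)]
  exact mul_le_mul (mul_le_mul_of_nonneg_left h2 hB) (add_le_add (h3 x) (h3 y)) (by positivity)
    (by positivity)

/-! ### Potentials: measurability and differentiation -/

/-- The potential `∫ t^{-d/2} e^{-v} P(v) dν(y)`, where `v = π |x - y|² / t`. -/
noncomputable def polyPot (d : ℕ) (ν : Measure (EuclideanSpace ℝ (Fin n))) (P : ℝ[X])
    (x : EuclideanSpace ℝ (Fin n)) (t : ℝ) : ℝ :=
  ∫ y, polyKernel d P t (x - y) ∂ν

/-- The squared Littlewood-Paley function of a polynomial Gaussian kernel, restricted to the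
scales in `I`. -/
noncomputable def sqFun (d : ℕ) (ν : Measure (EuclideanSpace ℝ (Fin n))) (P : ℝ[X]) (I : Set ℝ)
    (x : EuclideanSpace ℝ (Fin n)) : ℝ≥0∞ :=
  ∫⁻ t in I, ENNReal.ofReal (polyPot d ν P x t ^ 2 / t)

theorem measurable_polyKernel_uncurry (d : ℕ) (P : ℝ[X]) :
    Measurable fun p : ℝ × EuclideanSpace ℝ (Fin n) => polyKernel d P p.1 p.2 := by
  have hP : Measurable fun v : ℝ => P.eval v := P.continuous.measurable
  unfold polyKernel
  have h : Measurable fun p : ℝ × EuclideanSpace ℝ (Fin n) => Real.pi * ‖p.2‖ ^ 2 / p.1 := by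
    fun_prop
  exact (measurable_fst.pow_const _).mul (h.neg.exp.mul (hP.comp h))

theorem integrable_polyKernel (d : ℕ) (P : ℝ[X]) (ν : Measure (EuclideanSpace ℝ (Fin n)))
    [IsFiniteMeasure ν] (x : EuclideanSpace ℝ (Fin n)) {t : ℝ} (ht : 0 < t) :
    Integrable (fun y => polyKernel d P t (x - y)) ν := by
  obtain ⟨B, hB, h⟩ := exists_abs_polyKernel_le (n := n) d P
  refine Integrable.of_bound (C := B * (t ^ (-(d : ℝ) / 2) * 1)) ?_ (ae_of_all _ fun y => ?_)
  · have hm := measurable_polyKernel_uncurry (n := n) d P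
    exact (hm.comp (measurable_const.prodMk
      (measurable_const.sub measurable_id))).aestronglyMeasurable
  · refine (h t (x - y) ht).trans ?_
    have := Real.rpow_nonneg ht.le (-(d : ℝ) / 2)
    gcongr
    exact Real.exp_le_one_iff.2 (neg_nonpos.2 (by positivity))

theorem measurable_polyPot_uncurry (d : ℕ) (ν : Measure (EuclideanSpace ℝ (Fin n)))
    [IsFiniteMeasure ν] (P : ℝ[X]) :
    Measurable fun p : EuclideanSpace ℝ (Fin n) × ℝ => polyPot d ν P p.1 p.2 := by
  have hm := measurable_polyKernel_uncurry (n := n) d P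
  have h : Measurable fun q : (EuclideanSpace ℝ (Fin n) × ℝ) × EuclideanSpace ℝ (Fin n) =>
      polyKernel d P q.1.2 (q.1.1 - q.2) :=
    hm.comp ((measurable_snd.comp measurable_fst).prodMk
      ((measurable_fst.comp measurable_fst).sub measurable_snd))
  exact (h.stronglyMeasurable.integral_prod_right (ν := ν)).measurable

theorem measurable_polyPot_sq_div (d : ℕ) (ν : Measure (EuclideanSpace ℝ (Fin n)))
    [IsFiniteMeasure ν] (P : ℝ[X]) (x : EuclideanSpace ℝ (Fin n)) :
    Measurable fun t => ENNReal.ofReal (polyPot d ν P x t ^ 2 / t) := by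
  have h : Measurable fun t => polyPot d ν P x t :=
    (measurable_polyPot_uncurry d ν P).comp (measurable_const.prodMk measurable_id)
  exact ((h.pow_const 2).div measurable_id).ennreal_ofReal

theorem measurable_sqFun (d : ℕ) (ν : Measure (EuclideanSpace ℝ (Fin n)))
    [IsFiniteMeasure ν] (P : ℝ[X]) (I : Set ℝ) : Measurable (sqFun d ν P I) := by
  have h := measurable_polyPot_uncurry d ν P
  have h2 : Measurable fun p : EuclideanSpace ℝ (Fin n) × ℝ =>
      ENNReal.ofReal (polyPot d ν P p.1 p.2 ^ 2 / p.2) :=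
    ((h.pow_const 2).div measurable_snd).ennreal_ofReal
  exact h2.lintegral_prod_right'

theorem polyPot_add (d : ℕ) (ν : Measure (EuclideanSpace ℝ (Fin n))) [IsFiniteMeasure ν]
    (P Q : ℝ[X]) (x : EuclideanSpace ℝ (Fin n)) {t : ℝ} (ht : 0 < t) :
    polyPot d ν (P + Q) x t = polyPot d ν P x t + polyPot d ν Q x t := by
  simp only [polyPot, polyKernel_add]
  exact integral_add (integrable_polyKernel d P ν x ht) (integrable_polyKernel d Q ν x ht)

theorem polyPot_C_mul (d : ℕ) (ν : Measure (EuclideanSpace ℝ (Fin n)))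
    (c : ℝ) (P : ℝ[X]) (x : EuclideanSpace ℝ (Fin n)) (t : ℝ) :
    polyPot d ν (C c * P) x t = c * polyPot d ν P x t := by
  simp only [polyPot, polyKernel_C_mul, integral_const_mul]

theorem hasDerivAt_polyPot (d : ℕ) (ν : Measure (EuclideanSpace ℝ (Fin n))) [IsFiniteMeasure ν]
    (P : ℝ[X]) (x : EuclideanSpace ℝ (Fin n)) {t : ℝ} (ht : 0 < t) :
    HasDerivAt (polyPot d ν P x) (polyPot d ν (eulerOp d P) x t / t) t := by
  obtain ⟨B, hB, h⟩ := exists_abs_polyKernel_le (n := n) d (eulerOp d P)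
  have ht2 : 0 < t / 2 := by positivity
  have hmeas : ∀ s, AEStronglyMeasurable (fun y => polyKernel d P s (x - y)) ν := fun s =>
    ((measurable_polyKernel_uncurry (n := n) d P).comp (measurable_const.prodMk
      (measurable_const.sub measurable_id))).aestronglyMeasurable
  have key := hasDerivAt_integral_of_dominated_loc_of_deriv_le (μ := ν)
    (F := fun s y => polyKernel d P s (x - y))
    (F' := fun s y => polyKernel d (eulerOp d P) s (x - y) / s) (x₀ := t)
    (s := Ioi (t / 2)) (bound := fun _ => B * ((t / 2) ^ (-(d : ℝ) / 2) * 1) / (t / 2))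
    (Ioi_mem_nhds (by linarith)) (Filter.Eventually.of_forall hmeas)
    (integrable_polyKernel d P ν x ht)
    ((integrable_polyKernel d (eulerOp d P) ν x ht).div_const t).aestronglyMeasurable
    (ae_of_all _ fun y s hs => ?_) (integrable_const _)
    (ae_of_all _ fun y s hs => hasDerivAt_polyKernel d P (x - y) (ht2.trans hs))
  · refine key.2.congr_deriv ?_
    rw [integral_div, polyPot]
  · have hs0 : 0 < s := ht2.trans hs
    have hs' : t / 2 ≤ s := le_of_lt hs
    rw [norm_div, Real.norm_eq_abs, Real.norm_eq_abs, abs_of_pos hs0]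
    refine div_le_div₀ (by positivity) ((h s (x - y) hs0).trans ?_) ht2 hs'
    have h1 : s ^ (-(d : ℝ) / 2) ≤ (t / 2) ^ (-(d : ℝ) / 2) :=
      Real.rpow_le_rpow_of_nonpos ht2 hs' (div_nonpos_of_nonpos_of_nonneg (by simp) (by norm_num))
    gcongr
    exact Real.exp_le_one_iff.2 (neg_nonpos.2 (by positivity))

theorem hasDerivAt_polyPot_rpow (d : ℕ) (ν : Measure (EuclideanSpace ℝ (Fin n)))
    [IsFiniteMeasure ν] (P : ℝ[X]) (x : EuclideanSpace ℝ (Fin n)) {a : ℝ} (ha : 0 < a) (τ : ℝ) :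
    HasDerivAt (fun τ => polyPot d ν P x (a ^ τ))
      (Real.log a * polyPot d ν (eulerOp d P) x (a ^ τ)) τ := by
  have hpos : 0 < a ^ τ := Real.rpow_pos_of_pos ha τ
  have h := (hasDerivAt_polyPot d ν P x hpos).comp τ
    ((hasDerivAt_id τ).const_rpow ha)
  refine h.congr_deriv ?_
  simp only [mul_one]
  field_simp

theorem SLog_eq_polyPot (d : ℕ) (ν : Measure (EuclideanSpace ℝ (Fin n))) {a : ℝ} (ha : 0 < a)
    (x : EuclideanSpace ℝ (Fin n)) :
    SLog d ν a x = fun τ => polyPot d ν (eulerOp d 1) x (a ^ τ) := by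
  funext τ
  simp only [SLog, S, polyPot, psi_eq_polyKernel d _ (Real.rpow_pos_of_pos ha τ)]

/-- Each `∂/∂τ` is `log a` times `t∂ₜ`; the iterate is `k + 1` because `ψ` already carries one
`t∂ₜ`. -/
theorem iteratedDeriv_SLog (d : ℕ) (ν : Measure (EuclideanSpace ℝ (Fin n))) [IsFiniteMeasure ν]
    {a : ℝ} (ha : 0 < a) (x : EuclideanSpace ℝ (Fin n)) (k : ℕ) :
    iteratedDeriv k (SLog d ν a x) =
      fun τ => Real.log a ^ k * polyPot d ν ((eulerOp d)^[k + 1] 1) x (a ^ τ) := by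
  induction k with
  | zero => simp [SLog_eq_polyPot d ν ha x]
  | succ k ih =>
    rw [iteratedDeriv_succ, ih]
    funext τ
    rw [((hasDerivAt_polyPot_rpow d ν _ x ha τ).const_mul _).deriv,
      Function.iterate_succ_apply' (eulerOp d) (k + 1)]
    ring

theorem hasDerivAt_iteratedDeriv_SLog (d : ℕ) (ν : Measure (EuclideanSpace ℝ (Fin n)))
    [IsFiniteMeasure ν] {a : ℝ} (ha : 0 < a) (x : EuclideanSpace ℝ (Fin n)) (k : ℕ) (τ : ℝ) :
    HasDerivAt (iteratedDeriv k (SLog d ν a x)) (iteratedDeriv (k + 1) (SLog d ν a x) τ) τ := by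
  rw [iteratedDeriv_succ, hasDerivAt_deriv_iff, iteratedDeriv_SLog d ν ha x k]
  exact ((hasDerivAt_polyPot_rpow d ν _ x ha τ).const_mul _).differentiableAt

/-! ### L² bounds tested on indicators -/

/-- `L²` boundedness of a square function, tested on indicator functions. -/
def SqFunTest (d : ℕ) (μ : Measure (EuclideanSpace ℝ (Fin n))) (P : ℝ[X]) : Prop :=
  ∃ A : ℝ≥0, ∀ E : Set (EuclideanSpace ℝ (Fin n)), MeasurableSet E →
    ∫⁻ x, sqFun d (μ.restrict E) P (Ioi 0) x ∂μ ≤ A * μ E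

theorem LittlewoodPaleyBounded.sqFunTest {d : ℕ} {μ : Measure (EuclideanSpace ℝ (Fin n))}
    [IsFiniteMeasure μ] (h : LittlewoodPaleyBounded d μ) {k : ℕ} (hk : 1 ≤ k) :
    SqFunTest d μ (heatPoly d k) := by
  obtain ⟨A, hA⟩ := h k hk
  refine ⟨A ^ 2, fun E hE => ?_⟩
  have h1 := hA (E.indicator fun _ => (1 : ℝ)) (memLp_indicator_const 2 hE 1 (Or.inr
    (measure_ne_top μ E)))
  have hlp : ∀ x, littlewoodPaley d μ k (E.indicator fun _ => (1 : ℝ)) x =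
      sqFun d (μ.restrict E) (heatPoly d k) (Ioi 0) x ^ (1 / 2 : ℝ) := by
    intro x
    rw [littlewoodPaley, sqFun]
    congr 1
    refine setLIntegral_congr_fun measurableSet_Ioi fun t ht => ?_
    have ht0 : (0 : ℝ) < t := ht
    have : ∫ y, iteratedDeriv k (fun s => heatKernel d s (x - y)) t *
        E.indicator (fun _ => (1 : ℝ)) y ∂μ = polyPot d (μ.restrict E) (heatPoly d k) x t / t ^ k := by
      rw [polyPot, ← integral_div, ← integral_indicator hE]
      refine integral_congr_ae (ae_of_all _ fun y => ?_)
      by_cases hy : y ∈ E <;> simp [hy, iteratedDeriv_heatKernel d k _ ht0]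
    rw [this, mul_div_cancel₀ _ (pow_ne_zero k ht0.ne')]
  rw [eLpNorm_indicator_const hE two_ne_zero (by simp),
    eLpNorm_eq_lintegral_rpow_enorm_toReal two_ne_zero (by simp)] at h1
  simp only [hlp, enorm_eq_self, ENNReal.toReal_ofNat, ← ENNReal.rpow_mul] at h1
  norm_num at h1
  -- Squaring removes the roots of both `L²` norms, which is why the constant becomes `A ^ 2`.
  have h2 := ENNReal.rpow_le_rpow h1 (z := 2) (by norm_num)
  rw [ENNReal.mul_rpow_of_nonneg _ _ (by norm_num), ← ENNReal.rpow_mul, ← ENNReal.rpow_mul] at h2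
  norm_num at h2
  simpa using h2

theorem SqFunTest.add {d : ℕ} {μ : Measure (EuclideanSpace ℝ (Fin n))} [IsFiniteMeasure μ]
    {P Q : ℝ[X]} (hP : SqFunTest d μ P) (hQ : SqFunTest d μ Q) : SqFunTest d μ (P + Q) := by
  obtain ⟨A, hA⟩ := hP
  obtain ⟨B, hB⟩ := hQ
  refine ⟨2 * A + 2 * B, fun E hE => ?_⟩
  have htwo : ∀ r : ℝ, 2 * ENNReal.ofReal r = ENNReal.ofReal (2 * r) := fun r => by
    rw [ENNReal.ofReal_mul (by norm_num), ENNReal.ofReal_ofNat]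
  have hpt : ∀ x, sqFun d (μ.restrict E) (P + Q) (Ioi 0) x ≤
      2 * sqFun d (μ.restrict E) P (Ioi 0) x + 2 * sqFun d (μ.restrict E) Q (Ioi 0) x := by
    intro x
    have hm := measurable_polyPot_sq_div d (μ.restrict E)
    rw [sqFun, sqFun, sqFun, ← lintegral_const_mul _ (hm P x), ← lintegral_const_mul _ (hm Q x),
      ← lintegral_add_left ((hm P x).const_mul 2)]
    refine setLIntegral_mono' measurableSet_Ioi fun t ht => ?_
    have ht0 : (0 : ℝ) < t := ht
    rw [polyPot_add d _ P Q x ht0, ← mul_add, ← ENNReal.ofReal_add (by positivity) (by positivity), htwo]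
    refine ENNReal.ofReal_le_ofReal ?_
    rw [← add_div, ← mul_div_assoc]
    gcongr
    exact add_sq_le
  calc _ ≤ ∫⁻ x, 2 * sqFun d (μ.restrict E) P (Ioi 0) x +
        2 * sqFun d (μ.restrict E) Q (Ioi 0) x ∂μ := lintegral_mono hpt
    _ = 2 * ∫⁻ x, sqFun d (μ.restrict E) P (Ioi 0) x ∂μ +
        2 * ∫⁻ x, sqFun d (μ.restrict E) Q (Ioi 0) x ∂μ := by
      have hm := measurable_sqFun d (μ.restrict E)
      rw [lintegral_add_left ((hm P _).const_mul 2), lintegral_const_mul _ (hm P _),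
        lintegral_const_mul _ (hm Q _)]
    _ ≤ 2 * (A * μ E) + 2 * (B * μ E) := by gcongr <;> [exact hA E hE; exact hB E hE]
    _ = _ := by push_cast; ring

theorem SqFunTest.C_mul {d : ℕ} {μ : Measure (EuclideanSpace ℝ (Fin n))} [IsFiniteMeasure μ]
    {P : ℝ[X]} (hP : SqFunTest d μ P) (c : ℝ) : SqFunTest d μ (C c * P) := by
  obtain ⟨A, hA⟩ := hP
  refine ⟨Real.toNNReal (c ^ 2) * A, fun E hE => ?_⟩
  have hpt : ∀ x, sqFun d (μ.restrict E) (C c * P) (Ioi 0) x =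
      ENNReal.ofReal (c ^ 2) * sqFun d (μ.restrict E) P (Ioi 0) x := by
    intro x
    rw [sqFun, sqFun, ← lintegral_const_mul _ (measurable_polyPot_sq_div d (μ.restrict E) P x)]
    simp only [polyPot_C_mul, mul_pow, mul_div_assoc, ENNReal.ofReal_mul (sq_nonneg c)]
  simp only [hpt]
  rw [lintegral_const_mul _ (measurable_sqFun d (μ.restrict E) P _), ENNReal.coe_mul, mul_assoc]
  exact mul_le_mul_right (hA E hE) _

theorem LittlewoodPaleyBounded.sqFunTest_eulerOp {d : ℕ}
    {μ : Measure (EuclideanSpace ℝ (Fin n))} [IsFiniteMeasure μ]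
    (h : LittlewoodPaleyBounded d μ) : SqFunTest d μ ((eulerOp d)^[3] 1) := by
  rw [eulerOp_iterate_three]
  exact ((h.sqFunTest le_rfl).add ((h.sqFunTest one_le_two).C_mul 3)).add
    (h.sqFunTest (by norm_num))

/-! ### Upper regularity from the first Littlewood–Paley function -/

/-- Upper `d`-regularity: `μ(B(x,r)) ≤ A r^d`. -/
def UpperRegular (d : ℕ) (μ : Measure (EuclideanSpace ℝ (Fin n))) : Prop :=
  ∃ A : ℝ, 0 ≤ A ∧ ∀ (x : EuclideanSpace ℝ (Fin n)) (r : ℝ), 0 < r →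
    μ.real (Metric.ball x r) ≤ A * r ^ d

theorem sqrt_pow_eq_rpow (d : ℕ) {t : ℝ} (ht : 0 ≤ t) : √t ^ d = t ^ ((d : ℝ) / 2) := by
  rw [Real.sqrt_eq_rpow, ← Real.rpow_natCast, ← Real.rpow_mul ht]
  congr 1
  ring

/-- The polynomial is `v - d/2`. The range of `t` makes `v ≤ 1/4`, so with `d ≥ 1` the kernel has a
definite negative sign and no cancellation can occur. -/
theorem polyKernel_heatPoly_one_le {d : ℕ} (hd : 1 ≤ d) {r t : ℝ} (hr : 0 < r)
    (ht1 : 16 * Real.pi * r ^ 2 ≤ t) (ht2 : t ≤ 32 * Real.pi * r ^ 2)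
    {x : EuclideanSpace ℝ (Fin n)} (hx : ‖x‖ ≤ 2 * r) :
    polyKernel d (heatPoly d 1) t x ≤
      -(Real.exp (-1) / 4 * (32 * Real.pi) ^ (-(d : ℝ) / 2) / r ^ d) := by
  have hpi := Real.pi_pos
  have ht : 0 < t := lt_of_lt_of_le (by positivity) ht1
  have hd1 : (1 : ℝ) ≤ d := by exact_mod_cast hd
  have hv : Real.pi * ‖x‖ ^ 2 / t ≤ 1 / 4 := by
    rw [div_le_iff₀ ht]
    have : ‖x‖ ^ 2 ≤ (2 * r) ^ 2 := pow_le_pow_left₀ (norm_nonneg x) hx 2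
    nlinarith
  have hP : (heatPoly d 1).eval (Real.pi * ‖x‖ ^ 2 / t) = Real.pi * ‖x‖ ^ 2 / t - d / 2 := by
    simp [heatPoly, eulerOp]
  rw [polyKernel, hP]
  have h1 : (32 * Real.pi) ^ (-(d : ℝ) / 2) / r ^ d ≤ t ^ (-(d : ℝ) / 2) := by
    have h2 : (32 * Real.pi * r ^ 2) ^ (-(d : ℝ) / 2) ≤ t ^ (-(d : ℝ) / 2) :=
      Real.rpow_le_rpow_of_nonpos ht ht2
        (div_nonpos_of_nonpos_of_nonneg (by simp) (by norm_num))
    rw [Real.mul_rpow (by positivity) (by positivity), neg_div, Real.rpow_neg (sq_nonneg r),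
      ← sqrt_pow_eq_rpow d (sq_nonneg r), Real.sqrt_sq hr.le, ← div_eq_mul_inv] at h2
    rwa [neg_div]
  have h3 : Real.exp (-1) ≤ Real.exp (-(Real.pi * ‖x‖ ^ 2 / t)) :=
    Real.exp_le_exp.2 (by linarith)
  have h4 : 1 / 4 ≤ (d : ℝ) / 2 - Real.pi * ‖x‖ ^ 2 / t := by linarith
  have h5 : (32 * Real.pi) ^ (-(d : ℝ) / 2) / r ^ d * (Real.exp (-1) * (1 / 4)) ≤
      t ^ (-(d : ℝ) / 2) * (Real.exp (-(Real.pi * ‖x‖ ^ 2 / t)) *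
        ((d : ℝ) / 2 - Real.pi * ‖x‖ ^ 2 / t)) := by
    gcongr
  have h6 : Real.exp (-1) / 4 * (32 * Real.pi) ^ (-(d : ℝ) / 2) / r ^ d =
      (32 * Real.pi) ^ (-(d : ℝ) / 2) / r ^ d * (Real.exp (-1) * (1 / 4)) := by ring
  rw [h6]
  linarith

/-- With `m = μ(B)`, the potential of the ball is at most `-bm/r^d` at every point of `B`, over a
range of scales comparable to `r²`. The `L²` test on `1_B` then gives `(bm/r^d)²/2 ≤ A`, unless `m =
0`. -/
theorem SqFunTest.upperRegular {d : ℕ} (hd : 1 ≤ d) {μ : Measure (EuclideanSpace ℝ (Fin n))}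
    [IsFiniteMeasure μ] (h : SqFunTest d μ (heatPoly d 1)) : UpperRegular d μ := by
  obtain ⟨A, hA⟩ := h
  have hpi := Real.pi_pos
  set b : ℝ := Real.exp (-1) / 4 * (32 * Real.pi) ^ (-(d : ℝ) / 2) with hb
  have hb0 : 0 < b := by positivity
  refine ⟨√(2 * A) / b, by positivity, fun x r hr => ?_⟩
  set E := Metric.ball x r with hE
  have hEm : MeasurableSet E := Metric.isOpen_ball.measurableSet
  set m := μ.real E with hm
  have hm0 : 0 ≤ m := measureReal_nonneg
  have hpot : ∀ z ∈ E, ∀ t ∈ Icc (16 * Real.pi * r ^ 2) (32 * Real.pi * r ^ 2),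
      (b / r ^ d * m) ^ 2 / (32 * Real.pi * r ^ 2) ≤
        polyPot d (μ.restrict E) (heatPoly d 1) z t ^ 2 / t := by
    intro z hz t ht
    have ht0 : 0 < t := lt_of_lt_of_le (by positivity) ht.1
    have h1 : polyPot d (μ.restrict E) (heatPoly d 1) z t ≤ -(b / r ^ d * m) := by
      have h2 : polyPot d (μ.restrict E) (heatPoly d 1) z t ≤ ∫ _ in E, -(b / r ^ d) ∂μ := by
        refine setIntegral_mono_on (integrable_polyKernel d _ (μ.restrict E) z ht0)
          (integrable_const _) hEm fun y hy => ?_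
        refine polyKernel_heatPoly_one_le hd hr ht.1 ht.2 ?_
        rw [← dist_eq_norm]
        have := dist_triangle_right z y x
        have h3 := Metric.mem_ball.1 hz
        have h4 := Metric.mem_ball.1 hy
        linarith
      rw [setIntegral_const, smul_eq_mul] at h2
      linarith
    have h0 : 0 ≤ b / r ^ d * m := by positivity
    refine div_le_div₀ (sq_nonneg _) ?_ ht0 ht.2
    nlinarith
  have hsq : ∀ z ∈ E, ENNReal.ofReal ((b / r ^ d * m) ^ 2 / 2) ≤
      sqFun d (μ.restrict E) (heatPoly d 1) (Ioi 0) z := by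
    intro z hz
    calc ENNReal.ofReal ((b / r ^ d * m) ^ 2 / 2)
        = ∫⁻ _ in Icc (16 * Real.pi * r ^ 2) (32 * Real.pi * r ^ 2),
            ENNReal.ofReal ((b / r ^ d * m) ^ 2 / (32 * Real.pi * r ^ 2)) := by
          rw [setLIntegral_const, Real.volume_Icc, ← ENNReal.ofReal_mul (by positivity)]
          congr 1
          field_simp
          ring
      _ ≤ ∫⁻ t in Icc (16 * Real.pi * r ^ 2) (32 * Real.pi * r ^ 2),
            ENNReal.ofReal (polyPot d (μ.restrict E) (heatPoly d 1) z t ^ 2 / t) :=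
          setLIntegral_mono' measurableSet_Icc fun t ht => ENNReal.ofReal_le_ofReal (hpot z hz t ht)
      _ ≤ _ := lintegral_mono_set fun t ht => lt_of_lt_of_le (by positivity) ht.1
  have hle : ENNReal.ofReal ((b / r ^ d * m) ^ 2 / 2) * μ E ≤ A * μ E := by
    rw [← setLIntegral_const]
    exact (setLIntegral_mono' hEm hsq).trans ((setLIntegral_le_lintegral _ _).trans (hA E hEm))
  rcases eq_or_ne (μ E) 0 with h0 | h0
  · have : m = 0 := by rw [hm, Measure.real, h0, ENNReal.toReal_zero]
    rw [this]
    positivity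
  · rw [ENNReal.mul_le_mul_iff_left h0 (measure_ne_top μ E),
      ENNReal.ofReal_le_iff_le_toReal ENNReal.coe_ne_top, ENNReal.coe_toReal] at hle
    have h1 : b / r ^ d * m ≤ √(2 * A) := Real.le_sqrt_of_sq_le (by linarith)
    rw [div_mul_eq_mul_div, div_le_iff₀ (by positivity)] at h1
    rw [div_mul_eq_mul_div, le_div_iff₀ hb0]
    linarith

/-! ### Potential bounds under upper regularity -/

theorem UpperRegular.exists_integral_gauss_le {d : ℕ} {μ : Measure (EuclideanSpace ℝ (Fin n))}
    [IsFiniteMeasure μ] (h : UpperRegular d μ) :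
    ∃ B : ℝ, 0 ≤ B ∧ ∀ (x : EuclideanSpace ℝ (Fin n)) (t : ℝ), 0 < t →
      ∫ y, t ^ (-(d : ℝ) / 2) * Real.exp (-(‖x - y‖ ^ 2 / t / 2)) ∂μ ≤ B := by
  obtain ⟨A, hA, h⟩ := h
  have hsum : Summable fun j : ℕ => ((j : ℝ) + 1) ^ d * Real.exp (-(j / 2)) := by
    have h1 := (summable_nat_add_iff 1).2
      (Real.summable_pow_mul_exp_neg_nat_mul d (r := 1 / 2) (by norm_num))
    refine (h1.mul_right (Real.exp (1 / 2))).congr fun j => ?_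
    rw [mul_assoc, ← Real.exp_add]
    push_cast
    ring_nf
  have hnn : ∀ j : ℕ, 0 ≤ ((j : ℝ) + 1) ^ d * Real.exp (-(j / 2)) := fun j => by positivity
  have hts : 0 ≤ ∑' j : ℕ, ((j : ℝ) + 1) ^ d * Real.exp (-(j / 2)) := tsum_nonneg hnn
  refine ⟨A * ∑' j : ℕ, ((j : ℝ) + 1) ^ d * Real.exp (-(j / 2)), by positivity,
    fun x t ht => ?_⟩
  have hst := Real.sqrt_pos.2 ht
  have ht0 := Real.rpow_pos_of_pos ht (-(d : ℝ) / 2)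
  have hcancel : t ^ (-(d : ℝ) / 2) * √t ^ d = 1 := by
    rw [sqrt_pow_eq_rpow d ht.le, ← Real.rpow_add ht]
    simp [neg_div]
  rw [integral_eq_lintegral_of_nonneg_ae (ae_of_all _ fun y => by positivity)
    (by fun_prop)]
  refine ENNReal.toReal_le_of_le_ofReal (by positivity) ?_
  have hpt : ∀ y, ENNReal.ofReal (t ^ (-(d : ℝ) / 2) * Real.exp (-(‖x - y‖ ^ 2 / t / 2))) ≤
      ∑' j : ℕ, (Metric.ball x ((j + 1) * √t)).indicator
        (fun _ => ENNReal.ofReal (t ^ (-(d : ℝ) / 2) * Real.exp (-(j / 2)))) y := by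
    intro y
    -- Shells of width `√t`: the term of index `j` alone dominates, since `j ≤ j² ≤ |x - y|²/t`.
    set j := ⌊‖x - y‖ / √t⌋₊ with hj
    refine le_trans ?_ (ENNReal.le_tsum j)
    have hmem : y ∈ Metric.ball x ((j + 1) * √t) := by
      rw [Metric.mem_ball, dist_comm, dist_eq_norm, ← div_lt_iff₀ hst]
      exact Nat.lt_floor_add_one _
    rw [indicator_of_mem hmem]
    refine ENNReal.ofReal_le_ofReal (mul_le_mul_of_nonneg_left (Real.exp_le_exp.2 ?_) ht0.le)
    have h1 : (j : ℝ) ≤ ‖x - y‖ / √t := Nat.floor_le (by positivity)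
    have h2 : (j : ℝ) ≤ (j : ℝ) ^ 2 := by exact_mod_cast Nat.le_self_pow two_ne_zero j
    have h3 := pow_le_pow_left₀ (Nat.cast_nonneg j) h1 2
    rw [div_pow, Real.sq_sqrt ht.le] at h3
    linarith
  calc _ ≤ ∫⁻ y, ∑' j : ℕ, (Metric.ball x ((j + 1) * √t)).indicator
        (fun _ => ENNReal.ofReal (t ^ (-(d : ℝ) / 2) * Real.exp (-(j / 2)))) y ∂μ :=
        lintegral_mono hpt
    _ = ∑' j : ℕ, ENNReal.ofReal (t ^ (-(d : ℝ) / 2) * Real.exp (-(j / 2))) *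
        μ (Metric.ball x ((j + 1) * √t)) := by
      rw [lintegral_tsum fun j =>
        (measurable_const.indicator Metric.isOpen_ball.measurableSet).aemeasurable]
      exact tsum_congr fun j => lintegral_indicator_const Metric.isOpen_ball.measurableSet _
    _ ≤ ∑' j : ℕ, ENNReal.ofReal (A * (((j : ℝ) + 1) ^ d * Real.exp (-(j / 2)))) := by
      refine ENNReal.tsum_le_tsum fun j => ?_
      rw [← ofReal_measureReal, ← ENNReal.ofReal_mul (by positivity)]
      refine ENNReal.ofReal_le_ofReal ?_
      calc _ ≤ t ^ (-(d : ℝ) / 2) * Real.exp (-(j / 2)) * (A * ((j + 1) * √t) ^ d) := by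
            gcongr
            exact h x _ (by positivity)
        _ = (t ^ (-(d : ℝ) / 2) * √t ^ d) * (A * ((j + 1) ^ d * Real.exp (-(j / 2)))) := by
            rw [mul_pow]; ring
        _ = _ := by rw [hcancel, one_mul]
    _ = _ := by
      rw [← tsum_mul_left, ENNReal.ofReal_tsum_of_nonneg (fun j => mul_nonneg hA (hnn j))
        (hsum.mul_left A)]

theorem integrable_gauss (d : ℕ) (c : ℝ) (hc : 0 ≤ c) (μ : Measure (EuclideanSpace ℝ (Fin n)))
    [IsFiniteMeasure μ] (x : EuclideanSpace ℝ (Fin n)) {t : ℝ} (ht : 0 < t) :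
    Integrable (fun y => t ^ (-(d : ℝ) / 2) * Real.exp (-(‖x - y‖ ^ 2 / t / c))) μ := by
  refine Integrable.of_bound (C := t ^ (-(d : ℝ) / 2) * 1) (by fun_prop) (ae_of_all _ fun y => ?_)
  have := Real.rpow_nonneg ht.le (-(d : ℝ) / 2)
  rw [Real.norm_eq_abs, abs_of_nonneg (by positivity)]
  gcongr
  exact Real.exp_le_one_iff.2 (neg_nonpos.2 (by positivity))

theorem exp_neg_le_exp_neg_half {s : ℝ} (hs : 0 ≤ s) : Real.exp (-s) ≤ Real.exp (-(s / 2)) :=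
  Real.exp_le_exp.2 (by linarith)

theorem UpperRegular.exists_abs_polyPot_le {d : ℕ} {μ : Measure (EuclideanSpace ℝ (Fin n))}
    [IsFiniteMeasure μ] (h : UpperRegular d μ) (P : ℝ[X]) :
    ∃ B : ℝ, 0 ≤ B ∧ ∀ (x : EuclideanSpace ℝ (Fin n)) (t : ℝ), 0 < t →
      |polyPot d μ P x t| ≤ B := by
  obtain ⟨A, hA, h⟩ := h.exists_integral_gauss_le
  obtain ⟨B, hB, hK⟩ := exists_abs_polyKernel_le (n := n) d P
  refine ⟨B * A, by positivity, fun x t ht => ?_⟩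
  calc |polyPot d μ P x t|
      ≤ ∫ y, B * (t ^ (-(d : ℝ) / 2) * Real.exp (-(‖x - y‖ ^ 2 / t / 2))) ∂μ := by
        refine norm_integral_le_of_norm_le (f := fun y => polyKernel d P t (x - y))
          ((integrable_gauss d 2 (by norm_num) μ x ht).const_mul B)
          (ae_of_all _ fun y => (hK t (x - y) ht).trans ?_)
        have := Real.rpow_nonneg ht.le (-(d : ℝ) / 2)
        exact mul_le_mul_of_nonneg_left (mul_le_mul_of_nonneg_left
          (exp_neg_le_exp_neg_half (by positivity)) this) hB
    _ ≤ B * A := by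
        rw [integral_const_mul]
        exact mul_le_mul_of_nonneg_left (h x t ht) hB

/-- Uses only the total mass; it supplies the decay at large `t` that makes the square function
finite away from `t = 0`. -/
theorem exists_abs_polyPot_le_rpow (d : ℕ) (μ : Measure (EuclideanSpace ℝ (Fin n)))
    [IsFiniteMeasure μ] (P : ℝ[X]) :
    ∃ B : ℝ, 0 ≤ B ∧ ∀ (x : EuclideanSpace ℝ (Fin n)) (t : ℝ), 0 < t →
      |polyPot d μ P x t| ≤ B * t ^ (-(d : ℝ) / 2) := by
  obtain ⟨B, hB, hK⟩ := exists_abs_polyKernel_le (n := n) d P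
  refine ⟨B * μ.real univ, by positivity, fun x t ht => ?_⟩
  have := Real.rpow_nonneg ht.le (-(d : ℝ) / 2)
  have h1 := norm_integral_le_of_norm_le_const (μ := μ) (f := fun y => polyKernel d P t (x - y))
    (C := B * (t ^ (-(d : ℝ) / 2) * 1)) (ae_of_all _ fun y => (hK t (x - y) ht).trans (by
      gcongr
      exact Real.exp_le_one_iff.2 (neg_nonpos.2 (by positivity))))
  refine h1.trans_eq ?_
  ring

theorem UpperRegular.exists_abs_polyPot_sub_le {d : ℕ}
    {μ : Measure (EuclideanSpace ℝ (Fin n))}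
    [IsFiniteMeasure μ] (h : UpperRegular d μ) (P : ℝ[X]) :
    ∃ B : ℝ, 0 ≤ B ∧ ∀ (x y : EuclideanSpace ℝ (Fin n)) (t : ℝ), 0 < t →
      |polyPot d μ P x t - polyPot d μ P y t| ≤ B * (‖x - y‖ / √t) := by
  obtain ⟨A, hA, h⟩ := h.exists_integral_gauss_le
  obtain ⟨B, hB, hK⟩ := exists_abs_polyKernel_sub_le (n := n) d P
  refine ⟨B * (A + A), by positivity, fun x y t ht => ?_⟩
  have hst := Real.sqrt_pos.2 ht
  have hgx := integrable_gauss d 2 (by norm_num) μ x ht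
  have hgy := integrable_gauss d 2 (by norm_num) μ y ht
  rw [polyPot, polyPot, ← integral_sub (integrable_polyKernel d P μ x ht)
    (integrable_polyKernel d P μ y ht)]
  calc _ ≤ ∫ z, B * (‖x - y‖ / √t) * (t ^ (-(d : ℝ) / 2) * Real.exp (-(‖x - z‖ ^ 2 / t / 2)) +
        t ^ (-(d : ℝ) / 2) * Real.exp (-(‖y - z‖ ^ 2 / t / 2))) ∂μ := by
        refine norm_integral_le_of_norm_le
          (f := fun z => polyKernel d P t (x - z) - polyKernel d P t (y - z)) ((hgx.add hgy).const_mul _)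
          (ae_of_all _ fun z => ?_)
        have h1 := hK t (x - z) (y - z) ht
        rw [sub_sub_sub_cancel_right] at h1
        refine h1.trans ?_
        have := Real.rpow_nonneg ht.le (-(d : ℝ) / 2)
        exact mul_le_mul_of_nonneg_left (add_le_add
          (mul_le_mul_of_nonneg_left (exp_neg_le_exp_neg_half (by positivity)) this)
          (mul_le_mul_of_nonneg_left (exp_neg_le_exp_neg_half (by positivity)) this))
          (by positivity)
    _ = B * (‖x - y‖ / √t) * (∫ z, t ^ (-(d : ℝ) / 2) * Real.exp (-(‖x - z‖ ^ 2 / t / 2)) ∂μ +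
        ∫ z, t ^ (-(d : ℝ) / 2) * Real.exp (-(‖y - z‖ ^ 2 / t / 2)) ∂μ) := by
        rw [integral_const_mul, integral_add hgx hgy]
    _ ≤ B * (‖x - y‖ / √t) * (A + A) := by
        have := h x t ht
        have := h y t ht
        gcongr
    _ = _ := by ring

/-- Off `E` one has `|x - y| ≥ r`, and half of the Gaussian exponent is traded for the factor
`2t/r²` by `exp u ≥ u`. -/
theorem UpperRegular.exists_abs_polyPot_compl_le {d : ℕ}
    {μ : Measure (EuclideanSpace ℝ (Fin n))}
    [IsFiniteMeasure μ] (h : UpperRegular d μ) (P : ℝ[X]) :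
    ∃ B : ℝ, 0 ≤ B ∧ ∀ (x : EuclideanSpace ℝ (Fin n)) (r t : ℝ)
      (E : Set (EuclideanSpace ℝ (Fin n))), MeasurableSet E → Metric.ball x r ⊆ E → 0 < r → 0 < t →
      |polyPot d (μ.restrict Eᶜ) P x t| ≤ B * (t / r ^ 2) := by
  obtain ⟨A, hA, h⟩ := h.exists_integral_gauss_le
  obtain ⟨B, hB, hK⟩ := exists_abs_polyKernel_le (n := n) d P
  refine ⟨B * 2 * A, by positivity, fun x r t E hEm hE hr ht => ?_⟩
  have hg := integrable_gauss d 2 (by norm_num) μ x ht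
  have hrp := Real.rpow_nonneg ht.le (-(d : ℝ) / 2)
  calc |polyPot d (μ.restrict Eᶜ) P x t|
      ≤ ∫ y in Eᶜ, B * (2 * (t / r ^ 2)) *
          (t ^ (-(d : ℝ) / 2) * Real.exp (-(‖x - y‖ ^ 2 / t / 2))) ∂μ := by
        refine norm_integral_le_of_norm_le (f := fun y => polyKernel d P t (x - y))
          (hg.const_mul _).integrableOn
          ((ae_restrict_iff' hEm.compl).2 (ae_of_all _ fun y hy => (hK t (x - y) ht).trans ?_))
        have hxy : r ≤ ‖x - y‖ := by
          by_contra hlt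
          exact hy (hE (by rw [Metric.mem_ball, dist_comm, dist_eq_norm]; exact not_le.1 hlt))
        have h1 : Real.exp (-(‖x - y‖ ^ 2 / t)) ≤
            2 * (t / r ^ 2) * Real.exp (-(‖x - y‖ ^ 2 / t / 2)) := by
          have h2 : Real.exp (-(‖x - y‖ ^ 2 / t)) =
              Real.exp (-(‖x - y‖ ^ 2 / t / 2)) * Real.exp (-(‖x - y‖ ^ 2 / t / 2)) := by
            rw [← Real.exp_add]; congr 1; ring
          rw [h2]
          refine mul_le_mul_of_nonneg_right ?_ (Real.exp_nonneg _)
          have h3 : r ^ 2 / t / 2 ≤ ‖x - y‖ ^ 2 / t / 2 := by gcongr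
          have h4 := Real.add_one_le_exp (‖x - y‖ ^ 2 / t / 2)
          rw [Real.exp_neg, inv_le_comm₀ (Real.exp_pos _) (by positivity)]
          have h5 : (2 * (t / r ^ 2))⁻¹ = r ^ 2 / t / 2 := by field_simp
          linarith
        calc _ ≤ B * (t ^ (-(d : ℝ) / 2) *
              (2 * (t / r ^ 2) * Real.exp (-(‖x - y‖ ^ 2 / t / 2)))) := by gcongr
          _ = _ := by ring
    _ = B * (2 * (t / r ^ 2)) *
          ∫ y in Eᶜ, t ^ (-(d : ℝ) / 2) * Real.exp (-(‖x - y‖ ^ 2 / t / 2)) ∂μ :=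
        integral_const_mul _ _
    _ ≤ B * (2 * (t / r ^ 2)) * A := by
        gcongr
        exact (setIntegral_le_integral hg (ae_of_all _ fun y => by positivity)).trans (h x t ht)
    _ = _ := by ring

theorem polyPot_eq_add_compl (d : ℕ) (μ : Measure (EuclideanSpace ℝ (Fin n))) [IsFiniteMeasure μ]
    (P : ℝ[X]) (x : EuclideanSpace ℝ (Fin n)) {t : ℝ} (ht : 0 < t)
    {E : Set (EuclideanSpace ℝ (Fin n))} (hE : MeasurableSet E) :
    polyPot d μ P x t = polyPot d (μ.restrict E) P x t + polyPot d (μ.restrict Eᶜ) P x t :=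
  (integral_add_compl hE (integrable_polyKernel d P μ x ht)).symm

/-! ### Square functions: decay, oscillation, localization -/

theorem setLIntegral_Ioi_rpow {p s c : ℝ} (hp : p < -1) (hs : 0 < s) (hc : 0 ≤ c) :
    ∫⁻ t in Ioi s, ENNReal.ofReal (c * t ^ p) =
      ENNReal.ofReal (c * (-s ^ (p + 1) / (p + 1))) := by
  rw [← integral_Ioi_rpow_of_lt hp hs, ← integral_const_mul]
  exact (ofReal_integral_eq_lintegral_ofReal ((integrableOn_Ioi_rpow_of_lt hp hs).const_mul c)
    ((ae_restrict_iff' measurableSet_Ioi).2 (ae_of_all _ fun t ht =>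
      mul_nonneg hc (Real.rpow_nonneg (hs.trans ht).le p)))).symm

theorem sqFun_mono (d : ℕ) (ν : Measure (EuclideanSpace ℝ (Fin n))) (P : ℝ[X]) {I J : Set ℝ}
    (h : I ⊆ J) (x : EuclideanSpace ℝ (Fin n)) : sqFun d ν P I x ≤ sqFun d ν P J x :=
  lintegral_mono_set h

theorem exists_sqFun_Ioi_le_div {d : ℕ} (hd : 1 ≤ d) (μ : Measure (EuclideanSpace ℝ (Fin n)))
    [IsFiniteMeasure μ] (P : ℝ[X]) :
    ∃ B : ℝ, 0 ≤ B ∧ ∀ (x : EuclideanSpace ℝ (Fin n)) (s : ℝ), 1 ≤ s →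
      sqFun d μ P (Ioi s) x ≤ ENNReal.ofReal (B / s) := by
  obtain ⟨B, hB, h⟩ := exists_abs_polyPot_le_rpow d μ P
  refine ⟨B ^ 2, by positivity, fun x s hs => ?_⟩
  have hs0 : 0 < s := by linarith
  have hd1 : (1 : ℝ) ≤ d := by exact_mod_cast hd
  calc sqFun d μ P (Ioi s) x ≤ ∫⁻ t in Ioi s, ENNReal.ofReal (B ^ 2 * t ^ (-2 : ℝ)) := by
        refine setLIntegral_mono' measurableSet_Ioi fun t ht => ENNReal.ofReal_le_ofReal ?_
        have ht0 : 0 < t := hs0.trans ht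
        have ht1 : 1 ≤ t := hs.trans (le_of_lt ht)
        have h1 := pow_le_pow_left₀ (abs_nonneg _) (h x t ht0) 2
        rw [sq_abs, mul_pow, ← Real.rpow_natCast (t ^ _), ← Real.rpow_mul ht0.le] at h1
        have h2 : t ^ (-(d : ℝ) / 2 * (2 : ℕ)) ≤ t ^ (-1 : ℝ) :=
          Real.rpow_le_rpow_of_exponent_le ht1 (by push_cast; linarith)
        have h3 : t ^ (-2 : ℝ) = t ^ (-1 : ℝ) / t := by
          rw [← Real.rpow_sub_one ht0.ne']; norm_num
        rw [h3, ← mul_div_assoc]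
        refine div_le_div_of_nonneg_right (h1.trans ?_) ht0.le
        exact mul_le_mul_of_nonneg_left h2 (sq_nonneg B)
    _ = ENNReal.ofReal (B ^ 2 / s) := by
        rw [setLIntegral_Ioi_rpow (by norm_num) hs0 (sq_nonneg B)]
        congr 1
        norm_num
        rw [Real.rpow_neg_one, div_eq_mul_inv]

/-- Factor the difference of squares: the sum is bounded, the difference is `O(|x - y|/√t)`, and
`t^{-3/2}` integrates over `(s,∞)` to `2/√s`. -/
theorem UpperRegular.exists_sqFun_Ioi_le_add {d : ℕ} {μ : Measure (EuclideanSpace ℝ (Fin n))}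
    [IsFiniteMeasure μ] (h : UpperRegular d μ) (P : ℝ[X]) :
    ∃ B : ℝ, 0 ≤ B ∧ ∀ (x y : EuclideanSpace ℝ (Fin n)) (s : ℝ), 0 < s →
      sqFun d μ P (Ioi s) x ≤ sqFun d μ P (Ioi s) y + ENNReal.ofReal (B * (‖x - y‖ / √s)) := by
  obtain ⟨B, hB, h1⟩ := h.exists_abs_polyPot_le P
  obtain ⟨D, hD, h2⟩ := h.exists_abs_polyPot_sub_le P
  refine ⟨4 * B * D, by positivity, fun x y s hs => ?_⟩
  have hc : 0 ≤ 2 * B * D * ‖x - y‖ := by positivity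
  calc sqFun d μ P (Ioi s) x
      ≤ ∫⁻ t in Ioi s, (ENNReal.ofReal (polyPot d μ P y t ^ 2 / t) +
          ENNReal.ofReal (2 * B * D * ‖x - y‖ * t ^ (-(3 / 2) : ℝ))) := by
        refine setLIntegral_mono' measurableSet_Ioi fun t ht => ?_
        have ht0 : 0 < t := hs.trans ht
        rw [← ENNReal.ofReal_add (by positivity) (by positivity)]
        refine ENNReal.ofReal_le_ofReal ?_
        have h3 : t ^ (-(3 / 2) : ℝ) = 1 / √t / t := by
          rw [Real.sqrt_eq_rpow, one_div, ← Real.rpow_neg ht0.le, ← Real.rpow_sub_one ht0.ne']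
          norm_num
        rw [h3, ← mul_div_assoc, ← add_div]
        refine div_le_div_of_nonneg_right ?_ ht0.le
        have h4 := h2 x y t ht0
        have h5 : |polyPot d μ P x t + polyPot d μ P y t| ≤ 2 * B :=
          (abs_add_le _ _).trans (by linarith [h1 x t ht0, h1 y t ht0])
        have h6 := mul_le_mul h5 h4 (abs_nonneg _) (by positivity)
        rw [← abs_mul] at h6
        have h7 := (le_abs_self _).trans h6
        have h8 : 2 * B * D * ‖x - y‖ * (1 / √t) = 2 * B * (D * (‖x - y‖ / √t)) := by ring
        rw [h8]
        linarith
    _ = sqFun d μ P (Ioi s) y + ENNReal.ofReal (4 * B * D * (‖x - y‖ / √s)) := by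
        rw [lintegral_add_left (measurable_polyPot_sq_div d μ P y), sqFun,
          setLIntegral_Ioi_rpow (by norm_num) hs hc]
        congr 2
        norm_num
        rw [Real.rpow_neg hs.le, ← Real.sqrt_eq_rpow]
        ring

/-- The potential of the far mass is `O(t/r²)`, so its square is integrable against `dt/t` down to
`t = 0`. -/
theorem UpperRegular.exists_sqFun_Ioc_le_add {d : ℕ} {μ : Measure (EuclideanSpace ℝ (Fin n))}
    [IsFiniteMeasure μ] (h : UpperRegular d μ) (P : ℝ[X]) :
    ∃ B : ℝ, 0 ≤ B ∧ ∀ (x : EuclideanSpace ℝ (Fin n)) (r u : ℝ)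
      (E : Set (EuclideanSpace ℝ (Fin n))), MeasurableSet E → Metric.ball x r ⊆ E → 0 < r → 0 < u →
      sqFun d μ P (Ioc 0 u) x ≤
        2 * sqFun d (μ.restrict E) P (Ioi 0) x + ENNReal.ofReal (B * (u / r ^ 2) ^ 2) := by
  obtain ⟨B, hB, h⟩ := h.exists_abs_polyPot_compl_le P
  refine ⟨2 * B ^ 2, by positivity, fun x r u E hEm hE hr hu => ?_⟩
  have htwo : ∀ r : ℝ, ENNReal.ofReal (2 * r) = 2 * ENNReal.ofReal r := fun r => by
    rw [ENNReal.ofReal_mul (by norm_num), ENNReal.ofReal_ofNat]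
  calc sqFun d μ P (Ioc 0 u) x
      ≤ ∫⁻ t in Ioc 0 u, (2 * ENNReal.ofReal (polyPot d (μ.restrict E) P x t ^ 2 / t) +
          ENNReal.ofReal (2 * B ^ 2 * u / (r ^ 2) ^ 2)) := by
        refine setLIntegral_mono' measurableSet_Ioc fun t ht => ?_
        have ht0 : 0 < t := ht.1
        rw [← htwo, ← ENNReal.ofReal_add (by positivity) (by positivity),
          polyPot_eq_add_compl d μ P x ht0 hEm]
        refine ENNReal.ofReal_le_ofReal ?_
        have h1 := pow_le_pow_left₀ (abs_nonneg _) (h x r t E hEm hE hr ht0) 2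
        rw [sq_abs] at h1
        have h2 := add_sq_le (a := polyPot d (μ.restrict E) P x t)
          (b := polyPot d (μ.restrict Eᶜ) P x t)
        have h3 : (B * (t / r ^ 2)) ^ 2 / t ≤ B ^ 2 * u / (r ^ 2) ^ 2 := by
          have : (B * (t / r ^ 2)) ^ 2 / t = B ^ 2 * t / (r ^ 2) ^ 2 := by field_simp
          rw [this]
          gcongr
          exact ht.2
        calc _ ≤ 2 * (polyPot d (μ.restrict E) P x t ^ 2 + (B * (t / r ^ 2)) ^ 2) / t := by
              gcongr
              linarith
          _ = 2 * (polyPot d (μ.restrict E) P x t ^ 2 / t) +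
              2 * ((B * (t / r ^ 2)) ^ 2 / t) := by ring
          _ ≤ 2 * (polyPot d (μ.restrict E) P x t ^ 2 / t) +
              2 * (B ^ 2 * u / (r ^ 2) ^ 2) := by linarith
          _ = _ := by ring
    _ = 2 * sqFun d (μ.restrict E) P (Ioc 0 u) x + ENNReal.ofReal (2 * B ^ 2 * (u / r ^ 2) ^ 2) := by
        have hm := measurable_polyPot_sq_div d (μ.restrict E) P x
        rw [lintegral_add_left (hm.const_mul 2), lintegral_const_mul _ hm, sqFun,
          setLIntegral_const, Real.volume_Ioc, ← ENNReal.ofReal_mul (by positivity)]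
        congr 2
        ring
    _ ≤ _ := by
        gcongr
        exact sqFun_mono d _ P Ioc_subset_Ioi_self x

/-! ### Stopping scales and the John–Nirenberg inequality -/

theorem exists_scale {d : ℕ} (hd : 1 ≤ d) (μ : Measure (EuclideanSpace ℝ (Fin n)))
    [IsFiniteMeasure μ] (P : ℝ[X]) {l : ℝ} (hl : 1 ≤ l) {x : EuclideanSpace ℝ (Fin n)}
    (hx : ENNReal.ofReal l < sqFun d μ P (Ioi 0) x) :
    ∃ s : ℝ, 0 < s ∧ ENNReal.ofReal l < sqFun d μ P (Ioi s) x ∧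
      sqFun d μ P (Ioi (2 * s)) x ≤ ENNReal.ofReal l := by
  obtain ⟨B, hB, hdec⟩ := exists_sqFun_Ioi_le_div hd μ P
  -- The tail beyond `2^j` is at most `B/2^j ≤ 1 ≤ l` once `j ≥ B`; this is where `1 ≤ l` enters.
  have hbdd : ∃ b : ℤ, ∀ j : ℤ, ENNReal.ofReal l < sqFun d μ P (Ioi ((2 : ℝ) ^ j)) x → j ≤ b := by
    refine ⟨⌈B⌉₊, fun j hj => ?_⟩
    by_contra! hlt
    obtain ⟨m, rfl⟩ := Int.eq_ofNat_of_zero_le ((Int.natCast_nonneg _).trans hlt.le)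
    have hm : B ≤ m := (Nat.le_ceil B).trans (by exact_mod_cast hlt.le)
    have h2m : (m : ℝ) ≤ 2 ^ m := by exact_mod_cast Nat.lt_two_pow_self.le
    have h1 : (1 : ℝ) ≤ 2 ^ m := one_le_pow₀ one_le_two
    simp only [zpow_natCast] at hj
    refine (hj.trans_le (hdec x _ h1)).not_ge (ENNReal.ofReal_le_ofReal ?_)
    rw [div_le_iff₀ (by positivity)]
    nlinarith
  -- By monotone convergence the tails increase to the full square function, which exceeds `l`.
  have hne : ∃ j : ℤ, ENNReal.ofReal l < sqFun d μ P (Ioi ((2 : ℝ) ^ j)) x := by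
    by_contra! hall
    have hU : Ioi (0 : ℝ) = ⋃ m : ℕ, Ioi ((1 / 2 : ℝ) ^ m) := by
      ext t
      simp only [mem_Ioi, mem_iUnion]
      exact ⟨fun ht => exists_pow_lt_of_lt_one ht (by norm_num),
        fun ⟨m, hm⟩ => lt_trans (by positivity) hm⟩
    have hmono : Monotone fun m : ℕ => Ioi ((1 / 2 : ℝ) ^ m) := fun i j hij =>
      Ioi_subset_Ioi (pow_le_pow_of_le_one (by norm_num) (by norm_num) hij)
    refine hx.not_ge ?_
    rw [sqFun, hU, setLIntegral_iUnion_of_directed _ hmono.directed_le]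
    refine iSup_le fun m => ?_
    have := hall (-m)
    rwa [zpow_neg, zpow_natCast, ← inv_pow, ← one_div] at this
  obtain ⟨j, hj, hmax⟩ := Int.exists_greatest_of_bdd hbdd hne
  refine ⟨2 ^ j, by positivity, hj, ?_⟩
  by_contra! hlt
  have := hmax (j + 1) (by rwa [zpow_add_one₀ two_ne_zero, mul_comm])
  omega

theorem exists_measure_sqFun_half {d : ℕ} (hd : 1 ≤ d) {μ : Measure (EuclideanSpace ℝ (Fin n))}
    [IsFiniteMeasure μ] (hreg : UpperRegular d μ) {P : ℝ[X]} (hP : SqFunTest d μ P) :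
    ∃ K : ℝ, 0 < K ∧ ∀ l : ℝ, 0 ≤ l →
      μ.real {x | ENNReal.ofReal (l + K) ≤ sqFun d μ P (Ioi 0) x} ≤
        1 / 2 * μ.real {x | ENNReal.ofReal l ≤ sqFun d μ P (Ioi 0) x} := by
  obtain ⟨A, hA⟩ := hP
  obtain ⟨B, hB, hLip⟩ := hreg.exists_sqFun_Ioi_le_add P
  obtain ⟨D, hD, hloc⟩ := hreg.exists_sqFun_Ioc_le_add P
  -- `κ` keeps the oscillation on a stopping ball below 1, `T` is the far-mass error for `r = κ√s`
  -- and `u = 2s`, and `M` makes the Chebyshev factor `2A/M` at most `1/2`.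
  set κ : ℝ := 1 / (B + 1) with hκ
  have hκ0 : 0 < κ := by positivity
  have hBκ : B * κ ≤ 1 := by
    rw [hκ, mul_one_div, div_le_one (by positivity)]
    linarith
  set T : ℝ := D * (2 / κ ^ 2) ^ 2 with hT
  have hT0 : 0 ≤ T := by positivity
  set M : ℝ := 4 * (A + 1) with hM
  have hM0 : 0 < M := by positivity
  refine ⟨1 + T + M, by positivity, fun l hl => ?_⟩
  -- Stopping at height `l + 1` keeps the level at least 1 and leaves room for the oscillation, so
  -- that the balls stay above `l`.
  choose! s hs using fun x (hx : ENNReal.ofReal (l + 1) < sqFun d μ P (Ioi 0) x) =>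
    exists_scale hd μ P (by linarith : 1 ≤ l + 1) hx
  set E : Set (EuclideanSpace ℝ (Fin n)) :=
    ⋃ x ∈ {x | ENNReal.ofReal (l + 1) < sqFun d μ P (Ioi 0) x}, Metric.ball x (κ * √(s x)) with hE
  have hEm : MeasurableSet E :=
    (isOpen_biUnion fun x _ => Metric.isOpen_ball).measurableSet
  have hEsub : E ⊆ {x | ENNReal.ofReal l ≤ sqFun d μ P (Ioi 0) x} := by
    intro y hy
    simp only [hE, mem_iUnion] at hy
    obtain ⟨x, hx, hyx⟩ := hy
    obtain ⟨hs0, h1, -⟩ := hs x hx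
    have hst := Real.sqrt_pos.2 hs0
    have h2 : B * (‖x - y‖ / √(s x)) ≤ 1 := by
      refine le_trans (mul_le_mul_of_nonneg_left ?_ hB) hBκ
      rw [div_le_iff₀ hst, ← dist_eq_norm, dist_comm]
      exact (Metric.mem_ball.1 hyx).le
    have h3 := (h1.trans_le (hLip x y (s x) hs0)).le
    rw [ENNReal.ofReal_add hl zero_le_one] at h3
    have h4 : ENNReal.ofReal l + ENNReal.ofReal 1 ≤
        sqFun d μ P (Ioi 0) y + ENNReal.ofReal 1 :=
      h3.trans (add_le_add (sqFun_mono d μ P (Ioi_subset_Ioi hs0.le) y)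
        (ENNReal.ofReal_le_ofReal h2))
    exact (ENNReal.add_le_add_iff_right ENNReal.ofReal_ne_top).1 h4
  have hgood : {x | ENNReal.ofReal (l + (1 + T + M)) ≤ sqFun d μ P (Ioi 0) x} ⊆
      {x | ENNReal.ofReal M ≤ 2 * sqFun d (μ.restrict E) P (Ioi 0) x} := by
    intro x hx
    have hx1 : ENNReal.ofReal (l + 1) < sqFun d μ P (Ioi 0) x :=
      ((ENNReal.ofReal_lt_ofReal_iff (by linarith)).2 (by linarith)).trans_le hx
    obtain ⟨hs0, -, h1⟩ := hs x hx1
    have hst := Real.sqrt_pos.2 hs0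
    have hball : Metric.ball x (κ * √(s x)) ⊆ E := subset_biUnion_of_mem
      (u := fun x => Metric.ball x (κ * √(s x))) hx1
    have h2 := hloc x (κ * √(s x)) (2 * s x) E hEm hball (by positivity) (by positivity)
    have h3 : D * (2 * s x / (κ * √(s x)) ^ 2) ^ 2 = T := by
      rw [mul_pow, Real.sq_sqrt hs0.le, hT]
      field_simp
    rw [h3] at h2
    have h4 : sqFun d μ P (Ioi 0) x =
        sqFun d μ P (Ioc 0 (2 * s x)) x + sqFun d μ P (Ioi (2 * s x)) x := by
      rw [sqFun, ← Ioc_union_Ioi_eq_Ioi (by positivity : 0 ≤ 2 * s x),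
        lintegral_union measurableSet_Ioi Ioc_disjoint_Ioi_same]
      rfl
    have h5 : ENNReal.ofReal M + ENNReal.ofReal (T + (l + 1)) ≤
        2 * sqFun d (μ.restrict E) P (Ioi 0) x + ENNReal.ofReal (T + (l + 1)) := by
      calc ENNReal.ofReal M + ENNReal.ofReal (T + (l + 1))
          = ENNReal.ofReal (l + (1 + T + M)) := by
            rw [← ENNReal.ofReal_add hM0.le (by positivity)]
            congr 1
            ring
        _ ≤ _ := hx
        _ ≤ _ := h4.trans_le (add_le_add h2 h1)
        _ = _ := by rw [ENNReal.ofReal_add hT0 (by positivity), add_assoc]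
    exact (ENNReal.add_le_add_iff_right ENNReal.ofReal_ne_top).1 h5
  have hmeas := measurable_sqFun d (μ.restrict E) P (Ioi 0)
  have hcheb : ENNReal.ofReal M *
      μ {x | ENNReal.ofReal (l + (1 + T + M)) ≤ sqFun d μ P (Ioi 0) x} ≤
      2 * (A * μ {x | ENNReal.ofReal l ≤ sqFun d μ P (Ioi 0) x}) := by
    calc _ ≤ ENNReal.ofReal M * μ {x | ENNReal.ofReal M ≤ 2 * sqFun d (μ.restrict E) P (Ioi 0) x} := by
          gcongr
      _ ≤ ∫⁻ x, 2 * sqFun d (μ.restrict E) P (Ioi 0) x ∂μ :=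
          mul_meas_ge_le_lintegral₀ (hmeas.const_mul 2).aemeasurable _
      _ = 2 * ∫⁻ x, sqFun d (μ.restrict E) P (Ioi 0) x ∂μ := lintegral_const_mul _ hmeas
      _ ≤ 2 * (A * μ E) := by
          gcongr
          exact hA E hEm
      _ ≤ _ := by gcongr
  have hreal := ENNReal.toReal_mono (by finiteness) hcheb
  rw [ENNReal.toReal_mul, ENNReal.toReal_mul, ENNReal.toReal_mul, ENNReal.toReal_ofReal hM0.le,
    ENNReal.coe_toReal, ENNReal.toReal_ofNat] at hreal
  change M * μ.real _ ≤ 2 * (A * μ.real _) at hreal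
  have hA0 : (0 : ℝ) ≤ A := A.2
  have hnn : 0 ≤ μ.real {x | ENNReal.ofReal l ≤ sqFun d μ P (Ioi 0) x} := measureReal_nonneg
  have hfin : M * μ.real {x | ENNReal.ofReal (l + (1 + T + M)) ≤ sqFun d μ P (Ioi 0) x} ≤
      M * (1 / 2 * μ.real {x | ENNReal.ofReal l ≤ sqFun d μ P (Ioi 0) x}) := by
    refine hreal.trans ?_
    rw [hM]
    nlinarith
  exact le_of_mul_le_mul_left hfin hM0

theorem exists_measure_sqFun_pow {d : ℕ} (hd : 1 ≤ d) {μ : Measure (EuclideanSpace ℝ (Fin n))}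
    [IsFiniteMeasure μ] (hreg : UpperRegular d μ) {P : ℝ[X]} (hP : SqFunTest d μ P) :
    ∃ K : ℝ, 0 < K ∧ ∀ j : ℕ,
      μ.real {x | ENNReal.ofReal (j * K) ≤ sqFun d μ P (Ioi 0) x} ≤
        (1 / 2) ^ j * μ.real univ := by
  obtain ⟨K, hK, h⟩ := exists_measure_sqFun_half hd hreg hP
  refine ⟨K, hK, fun j => ?_⟩
  induction j with
  | zero => simp
  | succ j ih =>
    have h1 := h (j * K) (by positivity)
    rw [show (((j + 1 : ℕ) : ℝ) * K) = j * K + K by push_cast; ring, pow_succ]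
    linarith

/-- The John-Nirenberg inequality for the square function. -/
theorem exists_measure_sqFun_exp {d : ℕ} (hd : 1 ≤ d) {μ : Measure (EuclideanSpace ℝ (Fin n))}
    [IsFiniteMeasure μ] (hreg : UpperRegular d μ) {P : ℝ[X]} (hP : SqFunTest d μ P) :
    ∃ A c : ℝ, 0 < A ∧ 0 < c ∧ ∀ l : ℝ, 0 ≤ l →
      μ {x | ENNReal.ofReal l ≤ sqFun d μ P (Ioi 0) x} ≤
        ENNReal.ofReal (A * Real.exp (-(c * l))) := by
  obtain ⟨K, hK, h⟩ := exists_measure_sqFun_pow hd hreg hP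
  have hlog : 0 < Real.log 2 := Real.log_pos one_lt_two
  -- The 2 pays for rounding `l/K` down to an integer; the `+ 1` keeps the constant positive when `μ
  -- = 0`.
  refine ⟨2 * (μ.real univ + 1), Real.log 2 / K, by positivity, by positivity, fun l hl => ?_⟩
  rw [← ofReal_measureReal]
  refine ENNReal.ofReal_le_ofReal ?_
  set j := ⌊l / K⌋₊ with hj
  have h1 : j * K ≤ l := by
    rw [← le_div_iff₀ hK]
    exact Nat.floor_le (by positivity)
  have h2 : l / K < j + 1 := Nat.lt_floor_add_one _
  have h3 : (1 / 2 : ℝ) ^ j ≤ 2 * Real.exp (-(Real.log 2 / K * l)) := by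
    have h4 : (1 / 2 : ℝ) ^ j = 2 * Real.exp (-(Real.log 2 * (j + 1))) := by
      rw [← Real.exp_log (two_pos : (0 : ℝ) < 2), one_div, ← Real.exp_neg, ← Real.exp_nat_mul,
        ← Real.exp_add, Real.log_exp]
      congr 1
      ring
    rw [h4]
    have h5 : Real.log 2 / K * l = Real.log 2 * (l / K) := by ring
    rw [h5]
    gcongr
  calc _ ≤ μ.real {x | ENNReal.ofReal (j * K) ≤ sqFun d μ P (Ioi 0) x} :=
        measureReal_mono fun x hx => (ENNReal.ofReal_le_ofReal h1).trans hx
    _ ≤ (1 / 2) ^ j * μ.real univ := h j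
    _ ≤ 2 * Real.exp (-(Real.log 2 / K * l)) * (μ.real univ + 1) := by
        gcongr
        linarith
    _ = _ := by ring

/-! ### Counting local scales -/

theorem deriv_SLog_eq_zero {d : ℕ} {μ : Measure (EuclideanSpace ℝ (Fin n))} [IsFiniteMeasure μ]
    {a : ℝ} (ha : 1 < a) {x : EuclideanSpace ℝ (Fin n)} {τ β : ℝ} (hβ : 0 < β)
    (hτ : τ ∈ logLocalScales d μ a x) (hv : IsVisible d μ a β x τ) :
    iteratedDeriv 1 (SLog d μ a x) τ = 0 := by
  have ha0 : 0 < a := by linarith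
  obtain ⟨t, ⟨ht, hmax⟩, rfl⟩ := hτ
  have hat : a ^ Real.logb a t = t := Real.rpow_logb ha0 ha.ne' ht
  have hcont : ContinuousAt (fun τ : ℝ => a ^ τ) (Real.logb a t) :=
    (Real.continuous_const_rpow ha0.ne').continuousAt
  -- The square is differentiable where `|SΓ|` may not be; its derivative `2·SΓ·SΓ'` vanishes, and
  -- visibility rules out `SΓ = 0`.
  have hmax2 : IsLocalMax (fun τ => SLog d μ a x τ ^ 2) (Real.logb a t) := by
    have h1 : ∀ᶠ s in nhds (a ^ Real.logb a t), |S d μ x s| ≤ |S d μ x t| := by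
      rw [hat]; exact hmax
    filter_upwards [hcont.eventually h1] with τ hτ
    simp only [SLog, hat]
    exact sq_le_sq.2 hτ
  have hd := hasDerivAt_iteratedDeriv_SLog d μ ha0 x 0 (Real.logb a t)
  rw [iteratedDeriv_zero] at hd
  have h2 := hmax2.hasDerivAt_eq_zero (hd.fun_pow 2)
  have hne : SLog d μ a x (Real.logb a t) ≠ 0 := fun h0 => by
    rw [IsVisible, h0, abs_zero] at hv
    linarith
  simpa [hne] using h2

/-- Rolle gives a zero of `f'` between the two points, and `f'` needs length at least `δ/B` to fall
from above `δ` to 0. Applied with `f` the first `τ`-derivative of `SΓ`. -/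
theorem separation_of_scales {f f' f'' : ℝ → ℝ} {B δ τ₁ τ₂ : ℝ} (hB : 0 < B)
    (hf : ∀ τ, HasDerivAt f (f' τ) τ) (hf' : ∀ τ, HasDerivAt f' (f'' τ) τ)
    (hb : ∀ τ, |f'' τ| ≤ B) (h1 : f τ₁ = 0) (h2 : f τ₂ = 0) (hδ : δ < |f' τ₁|) (hlt : τ₁ < τ₂) :
    δ / B < τ₂ - τ₁ := by
  obtain ⟨ξ, hξ, h0⟩ := exists_hasDerivAt_eq_zero hlt
    (fun τ _ => (hf τ).continuousAt.continuousWithinAt) (h1.trans h2.symm) (fun τ _ => hf τ)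
  have h3 := convex_univ.norm_image_sub_le_of_norm_hasDerivWithin_le
    (fun τ _ => (hf' τ).hasDerivWithinAt) (fun τ _ => hb τ) (mem_univ ξ) (mem_univ τ₁)
  rw [h0, sub_zero, Real.norm_eq_abs, Real.norm_eq_abs, abs_sub_comm,
    abs_of_pos (sub_pos.2 hξ.1)] at h3
  rw [div_lt_iff₀ hB]
  nlinarith [hξ.2]

theorem setLIntegral_Ioi_div_eq_log_mul {a : ℝ} (ha : 1 < a) (g : ℝ → ℝ) :
    ∫⁻ t in Ioi (0 : ℝ), ENNReal.ofReal (g t / t) =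
      ENNReal.ofReal (Real.log a) * ∫⁻ τ : ℝ, ENNReal.ofReal (g (a ^ τ)) := by
  have ha0 : 0 < a := by linarith
  have hlog : 0 < Real.log a := Real.log_pos ha
  have himg : (fun τ : ℝ => a ^ τ) '' univ = Ioi (0 : ℝ) := by
    ext t
    simp only [image_univ, mem_range, mem_Ioi]
    exact ⟨fun ⟨τ, h⟩ => h ▸ Real.rpow_pos_of_pos ha0 τ,
      fun ht => ⟨Real.logb a t, Real.rpow_logb ha0 ha.ne' ht⟩⟩
  rw [← himg, lintegral_image_eq_lintegral_abs_deriv_mul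
    (f := fun τ : ℝ => a ^ τ) MeasurableSet.univ
    (fun τ _ => ((hasDerivAt_id τ).const_rpow ha0).hasDerivWithinAt)
    (Real.strictMono_rpow_of_base_gt_one ha).injective.injOn, setLIntegral_univ,
    ← lintegral_const_mul' _ _ ENNReal.ofReal_ne_top]
  refine lintegral_congr fun τ => ?_
  have hpos := Real.rpow_pos_of_pos ha0 τ
  simp only [id, mul_one]
  rw [← ENNReal.ofReal_mul (abs_nonneg _), ← ENNReal.ofReal_mul hlog.le,
    abs_of_pos (by positivity)]
  congr 1
  field_simp

theorem card_mul_le_lintegral_sq {f f' f'' : ℝ → ℝ} {B δ : ℝ} (hB : 0 < B) (hδ : 0 < δ)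
    (hf : ∀ τ, HasDerivAt f (f' τ) τ) (hf' : ∀ τ, HasDerivAt f' (f'' τ) τ)
    (hb : ∀ τ, |f'' τ| ≤ B) (F : Finset ℝ) (hF : ∀ τ ∈ F, f τ = 0 ∧ δ < |f' τ|) :
    ENNReal.ofReal (F.card * (δ ^ 3 / (4 * B))) ≤ ∫⁻ τ, ENNReal.ofReal (f' τ ^ 2) := by
  -- Half the separation, which makes the intervals disjoint, and also the distance over which `f'`
  -- loses at most `δ/2`; the yield per interval is `2h(δ/2)² = δ³/(4B)`.
  set h : ℝ := δ / (2 * B) with hh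
  have hh0 : 0 < h := by positivity
  have hhB : B * h = δ / 2 := by rw [hh]; field_simp
  have hsep : ∀ τ₁ ∈ F, ∀ τ₂ ∈ F, τ₁ < τ₂ → τ₁ + h ≤ τ₂ - h := by
    intro τ₁ h1 τ₂ h2 hlt
    have := separation_of_scales hB hf hf' hb (hF τ₁ h1).1 (hF τ₂ h2).1 (hF τ₁ h1).2 hlt
    have h3 : δ / B = 2 * h := by rw [hh]; field_simp
    linarith
  have hdisj : (F : Set ℝ).PairwiseDisjoint fun τ => Ioo (τ - h) (τ + h) := by
    intro τ₁ h1 τ₂ h2 hne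
    refine disjoint_left.2 fun u hu1 hu2 => ?_
    rcases lt_or_gt_of_ne hne with hlt | hlt
    · linarith [hsep τ₁ h1 τ₂ h2 hlt, hu1.2, hu2.1]
    · linarith [hsep τ₂ h2 τ₁ h1 hlt, hu2.2, hu1.1]
  have hloc : ∀ τ ∈ F, ENNReal.ofReal (δ ^ 3 / (4 * B)) ≤
      ∫⁻ u in Ioo (τ - h) (τ + h), ENNReal.ofReal (f' u ^ 2) := by
    intro τ hτ
    calc ENNReal.ofReal (δ ^ 3 / (4 * B))
        = ∫⁻ _ in Ioo (τ - h) (τ + h), ENNReal.ofReal ((δ / 2) ^ 2) := by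
          rw [setLIntegral_const, Real.volume_Ioo, ← ENNReal.ofReal_mul (by positivity), hh]
          congr 1
          field_simp
          ring
      _ ≤ _ := by
          refine setLIntegral_mono' measurableSet_Ioo fun u hu => ENNReal.ofReal_le_ofReal ?_
          have h3 := convex_univ.norm_image_sub_le_of_norm_hasDerivWithin_le
            (fun τ _ => (hf' τ).hasDerivWithinAt) (fun τ _ => hb τ) (mem_univ u) (mem_univ τ)
          have h4 : |τ - u| ≤ h := abs_sub_le_iff.2 ⟨by linarith [hu.1], by linarith [hu.2]⟩
          have h5 : |f' τ - f' u| ≤ δ / 2 :=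
            h3.trans (hhB ▸ mul_le_mul_of_nonneg_left h4 hB.le)
          have h6 := abs_sub_abs_le_abs_sub (f' τ) (f' u)
          rw [← sq_abs (f' u)]
          refine pow_le_pow_left₀ (by positivity) ?_ 2
          linarith [(hF τ hτ).2]
  calc ENNReal.ofReal (F.card * (δ ^ 3 / (4 * B)))
      = ∑ _τ ∈ F, ENNReal.ofReal (δ ^ 3 / (4 * B)) := by
        rw [Finset.sum_const, nsmul_eq_mul, ENNReal.ofReal_mul (by positivity),
          ENNReal.ofReal_natCast]
    _ ≤ ∑ τ ∈ F, ∫⁻ u in Ioo (τ - h) (τ + h), ENNReal.ofReal (f' u ^ 2) := Finset.sum_le_sum hloc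
    _ = ∫⁻ u in ⋃ τ ∈ F, Ioo (τ - h) (τ + h), ENNReal.ofReal (f' u ^ 2) :=
        (lintegral_biUnion_finset hdisj (fun _ _ => measurableSet_Ioo) _).symm
    _ ≤ _ := setLIntegral_le_lintegral _ _

theorem exists_manyScales_subset {d : ℕ} {Γ : Set (EuclideanSpace ℝ (Fin n))}
    {μ : Measure (EuclideanSpace ℝ (Fin n))} [IsFiniteMeasure μ] {a : ℝ} (ha : 1 < a)
    (hS : LogDerivBounded d Γ μ a) :
    ∃ c : ℝ, 0 < c ∧ ∀ (β δ : ℝ) (N : ℕ), 0 < β → 0 < δ →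
      manyScales d Γ μ a β δ N ⊆
        {x | ENNReal.ofReal (c * (N * δ ^ 3)) ≤ sqFun d μ ((eulerOp d)^[3] 1) (Ioi 0) x} := by
  have ha0 : 0 < a := by linarith
  have hlog : 0 < Real.log a := Real.log_pos ha
  obtain ⟨B, hB⟩ := hS 3
  set B' : ℝ := |B| + 1 with hB'
  have hB0 : 0 < B' := by positivity
  -- Two `τ`-derivatives, squared, give `(log a)⁴`, and `dt/t = log a dτ` takes one power back.
  refine ⟨1 / (4 * B' * Real.log a ^ 3), by positivity, fun β δ N hβ hδ x hx => ?_⟩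
  obtain ⟨hxΓ, hN⟩ := hx
  -- The set of scales may be infinite, so exactly `N` of them are selected.
  obtain ⟨F, hFsub, hFcard⟩ := exists_subset_encard_eq hN
  have hFfin : F.Finite := finite_of_encard_eq_coe hFcard
  lift F to Finset ℝ using hFfin
  rw [encard_coe_eq_coe_finsetCard, Nat.cast_inj] at hFcard
  have hcount := card_mul_le_lintegral_sq hB0 hδ (hasDerivAt_iteratedDeriv_SLog d μ ha0 x 1)
    (hasDerivAt_iteratedDeriv_SLog d μ ha0 x 2)
    (fun τ => (hB x hxΓ τ).trans ((le_abs_self B).trans (by linarith))) F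
    (fun τ hτ => ⟨deriv_SLog_eq_zero ha hβ (hFsub hτ).1 (hFsub hτ).2.1, (hFsub hτ).2.2⟩)
  have hint : ∫⁻ τ, ENNReal.ofReal (iteratedDeriv 2 (SLog d μ a x) τ ^ 2) =
      ENNReal.ofReal (Real.log a ^ 3) * sqFun d μ ((eulerOp d)^[3] 1) (Ioi 0) x := by
    rw [sqFun, setLIntegral_Ioi_div_eq_log_mul ha (fun t => polyPot d μ ((eulerOp d)^[3] 1) x t ^ 2)]
    rw [← mul_assoc, ← ENNReal.ofReal_mul (by positivity),
      ← lintegral_const_mul' _ _ ENNReal.ofReal_ne_top, iteratedDeriv_SLog d μ ha0 x 2]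
    refine lintegral_congr fun τ => ?_
    rw [← ENNReal.ofReal_mul (by positivity)]
    congr 1
    ring
  rw [hint, hFcard] at hcount
  have hL : ENNReal.ofReal (Real.log a ^ 3) ≠ 0 := (ENNReal.ofReal_pos.2 (by positivity)).ne'
  rw [mem_ofPred_eq, ← ENNReal.mul_le_mul_iff_right hL ENNReal.ofReal_ne_top,
    ← ENNReal.ofReal_mul (by positivity)]
  refine le_trans (le_of_eq ?_) hcount
  congr 1
  field_simp

end LocalScales

/-! ### Conclusion -/

theorem mainTheorem4 {n d : ℕ} (hd : 1 ≤ d) (hdn : d < n)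
    (Γ : Set (EuclideanSpace ℝ (Fin n))) (hΓ : MeasurableSet Γ) (hΓb : Bornology.IsBounded Γ)
    (hΓfin : (Measure.euclideanHausdorffMeasure d : Measure (EuclideanSpace ℝ (Fin n))) Γ < ⊤)
    (μ : Measure (EuclideanSpace ℝ (Fin n))) (hμ : LocalScales.IsSurfaceMeasure d Γ μ)
    (a : ℝ) (ha : 1 < a)
    (hLP : LocalScales.LittlewoodPaleyBounded d μ)
    (hS : LocalScales.LogDerivBounded d Γ μ a) :
    ∃ C₁ C₂ : ℝ, 0 < C₁ ∧ 0 < C₂ ∧ ∀ (β δ : ℝ) (N : ℕ), 0 < β → 0 < δ →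
      μ (LocalScales.manyScales d Γ μ a β δ N) ≤
        ENNReal.ofReal (C₁ * Real.exp (-C₂ * N * δ ^ 2 * min β δ)) := by
  have hfin : IsFiniteMeasure μ := by
    obtain ⟨c, hc, -⟩ := hμ
    refine ⟨(hc univ).trans_lt ?_⟩
    rw [Measure.smul_apply, Measure.restrict_apply_univ]
    exact ENNReal.mul_lt_top ENNReal.coe_lt_top hΓfin
  obtain ⟨A, c, hA, hc, hJN⟩ := LocalScales.exists_measure_sqFun_exp hd
    ((hLP.sqFunTest le_rfl).upperRegular hd) hLP.sqFunTest_eulerOp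
  obtain ⟨b, hb, hsub⟩ := LocalScales.exists_manyScales_subset ha hS
  refine ⟨A, c * b, hA, by positivity, fun β δ N hβ hδ => ?_⟩
  refine (measure_mono (hsub β δ N hβ hδ)).trans ((hJN _ (by positivity)).trans
    (ENNReal.ofReal_le_ofReal ?_))
  refine mul_le_mul_of_nonneg_left (Real.exp_le_exp.2 ?_) hA.le
  -- The argument yields the exponent `Nδ³`, which dominates the stated one.
  have h1 : c * b * N * δ ^ 2 * min β δ ≤ c * b * N * δ ^ 2 * δ :=
    mul_le_mul_of_nonneg_left (min_le_right β δ) (by positivity)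
  linarith
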